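/- A Pickands dependence function is a convex function $A:[0,1]\to[0,1]$ with $\max\{1-t,t\}\le A(t)\le 1$ for all $t\in[0,1]$. The associated bivariate extreme-value copula is $C_A(x,y)=(xy)^{A(\ln x/\ln(xy))}$ for $x,y\in(0,1)$, extended continuously to $[0,1]^2$, and $\mu_{C_A}$ denotes its doubly stochastic measure, i.e. the probability measure on $[0,1]^2$ with distribution function $C_A$. Let $\tau(A)=4\int_{[0,1]^2} C_A\,d\mu_{C_A}-1$ be Kendall's tau and $\rho(A)=12\int_{[0,1]^2} C_A(x,y)\,dx\,dy-3$ Spearman's rho of $C_A$. A Pickands dependence function is called triangular if for some $x\in(0,1)$ it is affine on $[0,x]$ and on $[x,1]$. Then: 1. Every Pickands dependence function $A$ satisfies $\rho(A)\ge \dfrac{3\tau(A)}{2+\tau(A)}$. 2. The bound is sharp: for every $u\in[0,1]$ there is a Pickands dependence function $A$, which can be chosen triangular, with $\tau(A)=u$ and $\rho(A)=\dfrac{3u}{2+u}$. 3. Every triangular Pickands dependence function $A$ satisfies $\rho(A)=\dfrac{3\tau(A)}{2+\tau(A)}$. -/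

import Mathlib

open MeasureTheory Set Filter Topology ProbabilityTheory

/-- Pickands dependence functions: convex functions `A` on `[0, 1]` with
`max {1 - t, t} ≤ A t ≤ 1`. Values outside `[0, 1]` are irrelevant. -/
def IsPickands (A : ℝ → ℝ) : Prop :=
  ConvexOn ℝ (Icc 0 1) A ∧ ∀ t ∈ Icc (0 : ℝ) 1, max (1 - t) t ≤ A t ∧ A t ≤ 1

/-- Triangular functions: affine on `[0, x]` and on `[x, 1]` for some `x ∈ (0, 1)`. -/
def IsTriangular (A : ℝ → ℝ) : Prop :=
  ∃ x ∈ Ioo (0 : ℝ) 1,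
    (∃ a b : ℝ, ∀ t ∈ Icc 0 x, A t = a + b * t) ∧ (∃ c d : ℝ, ∀ t ∈ Icc x 1, A t = c + d * t)

/-- The extreme-value copula `C_A (x, y) = (x y) ^ A (ln x / ln (x y))` on `[0, 1]²`.
On the boundary of the square the formula also gives the values of the copula (because
`Real.log 0 = 0`, `0 / 0 = 0` and `A 0 = A 1 = 1`); this is proved below. -/
noncomputable def evCopula (A : ℝ → ℝ) (x y : ℝ) : ℝ :=
  (x * y) ^ A (Real.log x / Real.log (x * y))

/-- `μ` is the doubly stochastic measure of the copula `C`: a probability measure with both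
marginals uniform on `[0, 1]` and with `μ ([0, x] × [0, y]) = C (x, y)` on `[0, 1]²`. -/
structure IsCopulaMeasure (C : ℝ → ℝ → ℝ) (μ : Measure (ℝ × ℝ)) : Prop where
  isProbabilityMeasure : IsProbabilityMeasure μ
  map_fst : μ.map Prod.fst = volume.restrict (Icc 0 1)
  map_snd : μ.map Prod.snd = volume.restrict (Icc 0 1)
  apply_Icc : ∀ x ∈ Icc (0 : ℝ) 1, ∀ y ∈ Icc (0 : ℝ) 1,
    μ (Icc 0 x ×ˢ Icc 0 y) = ENNReal.ofReal (C x y)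

/-- The doubly stochastic measure `μ_C` of a copula `C`. It is determined by `C`; for
`C = evCopula A` with `A` a Pickands function its existence is proved below. -/
noncomputable def copulaMeasure (C : ℝ → ℝ → ℝ) : Measure (ℝ × ℝ) :=
  Classical.epsilon (IsCopulaMeasure C)

/-- Kendall's tau of a copula: `τ(C) = 4 ∫ C dμ_C - 1`. -/
noncomputable def kendallTau (C : ℝ → ℝ → ℝ) : ℝ :=
  4 * (∫ p, C p.1 p.2 ∂(copulaMeasure C)) - 1

/-- Spearman's rho of a copula: `ρ(C) = 12 ∫ C dλ - 3`, over the unit square. -/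
noncomputable def spearmanRho (C : ℝ → ℝ → ℝ) : ℝ :=
  12 * (∫ p in Icc (0 : ℝ) 1 ×ˢ Icc (0 : ℝ) 1, C p.1 p.2) - 3

/- The rest of this file proves that `C_A` has a doubly stochastic measure. -/

namespace IsPickands

variable {A : ℝ → ℝ}

lemma at_zero (hA : IsPickands A) : A 0 = 1 := by
  have := hA.2 0 (by simp)
  simp at this; linarith

lemma at_one (hA : IsPickands A) : A 1 = 1 := by
  have := hA.2 1 (by simp)
  simp at this; linarith

lemma copula_zero_left (hA : IsPickands A) (y : ℝ) : evCopula A 0 y = 0 := by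
  simp [evCopula, hA.at_zero]

lemma copula_zero_right (hA : IsPickands A) (x : ℝ) : evCopula A x 0 = 0 := by
  simp [evCopula, hA.at_zero]

lemma copula_one_left (hA : IsPickands A) (y : ℝ) : evCopula A 1 y = y := by
  simp [evCopula, hA.at_zero]

lemma copula_one_right (hA : IsPickands A) {x : ℝ} (hx : x ∈ Icc (0 : ℝ) 1) :
    evCopula A x 1 = x := by
  rcases eq_or_lt_of_le hx.1 with h | h
  · rw [← h, hA.copula_zero_left]
  rcases eq_or_lt_of_le hx.2 with h' | h'
  · rw [h', hA.copula_one_left]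
  have : Real.log x ≠ 0 := (Real.log_neg h h').ne
  simp [evCopula, div_self this, hA.at_one]

lemma continuousOn (hA : IsPickands A) : ContinuousOn A (Icc 0 1) := by
  intro z hz
  have key : ∀ z ∈ Icc (0 : ℝ) 1, max (1 - z) z = 1 → ContinuousWithinAt A (Icc 0 1) z := by
    intro z hz h1
    have hAz : A z = 1 := le_antisymm (hA.2 z hz).2 (h1 ▸ (hA.2 z hz).1)
    have hc : Tendsto (fun t : ℝ => max (1 - t) t) (𝓝[Icc 0 1] z) (𝓝 (A z)) := by
      have hcm : Continuous fun t : ℝ => max (1 - t) t := by fun_prop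
      have ht := (hcm.tendsto z).mono_left (nhdsWithin_le_nhds (s := Icc 0 1))
      exact (hAz.trans h1.symm) ▸ ht
    refine tendsto_of_tendsto_of_tendsto_of_le_of_le' hc
      (hAz ▸ tendsto_const_nhds : Tendsto (fun _ => (1 : ℝ)) _ (𝓝 (A z))) ?_ ?_
    · filter_upwards [self_mem_nhdsWithin] with t ht using (hA.2 t ht).1
    · filter_upwards [self_mem_nhdsWithin] with t ht using (hA.2 t ht).2
  rcases eq_or_lt_of_le hz.1 with h | h
  · exact key z hz (by rw [← h]; norm_num)
  rcases eq_or_lt_of_le hz.2 with h' | h'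
  · exact key z hz (by rw [h']; norm_num)
  · have := hA.1.continuousOn_interior
    rw [interior_Icc] at this
    exact (this.continuousAt (Ioo_mem_nhds h h')).continuousWithinAt

/-- The right-hand derivative of `A`. -/
noncomputable def D (A : ℝ → ℝ) (z : ℝ) : ℝ := derivWithin A (Ioi z) z

/-- The height at `1` of the right tangent line of `A` at `z`. -/
noncomputable def K (A : ℝ → ℝ) (z : ℝ) : ℝ := A z + (1 - z) * D A z

lemma D_le_slope (hA : IsPickands A) {z w : ℝ} (hz : z ∈ Ioo (0 : ℝ) 1) (hw : w ≤ 1)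
    (h : z < w) : D A z * (w - z) ≤ A w - A z := by
  have := hA.1.rightDeriv_le_slope_of_mem_interior (x := z) (y := w)
    (by rwa [interior_Icc]) ⟨hz.1.le.trans h.le, hw⟩ h
  rw [slope_def_field, le_div_iff₀ (by linarith)] at this
  exact this

lemma D_mono (hA : IsPickands A) : MonotoneOn (D A) (Ioo 0 1) := by
  have := hA.1.monotoneOn_rightDeriv
  rwa [interior_Icc] at this

lemma hasDeriv (hA : IsPickands A) {z : ℝ} (hz : z ∈ Ioo (0 : ℝ) 1) :
    HasDerivWithinAt A (D A z) (Ioi z) z :=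
  hA.1.hasDerivWithinAt_rightDeriv_of_mem_interior (by rwa [interior_Icc])

lemma neg_one_le_D (hA : IsPickands A) {z : ℝ} (hz : z ∈ Ioo (0 : ℝ) 1) : -1 ≤ D A z := by
  have hz' : z ∈ interior (Icc (0 : ℝ) 1) := by rwa [interior_Icc]
  have h1 := hA.1.leftDeriv_le_rightDeriv_of_mem_interior hz'
  have h2 := hA.1.slope_le_leftDeriv_of_mem_interior (x := 0) (y := z) (by simp) hz' hz.1
  rw [slope_def_field, hA.at_zero] at h2
  have h3 := (hA.2 z ⟨hz.1.le, hz.2.le⟩).1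
  have h4 : -1 ≤ (A z - 1) / (z - 0) := by
    rw [le_div_iff₀ (by linarith [hz.1])]
    linarith [le_max_left (1 - z) z]
  exact h4.trans (h2.trans h1)

lemma K_mono (hA : IsPickands A) : MonotoneOn (K A) (Ioo 0 1) := by
  intro z hz w hw h
  rcases eq_or_lt_of_le h with rfl | h
  · exact le_rfl
  have h1 := hA.D_le_slope hz hw.2.le h
  have h2 := hA.D_mono hz hw h.le
  have h3 := mul_le_mul_of_nonneg_left h2 (sub_nonneg.2 hw.2.le)
  simp only [K]
  linarith

lemma K_le_one (hA : IsPickands A) {z : ℝ} (hz : z ∈ Ioo (0 : ℝ) 1) : K A z ≤ 1 := by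
  have h1 := hA.D_le_slope hz le_rfl hz.2
  rw [hA.at_one] at h1
  simp only [K]; linarith

lemma K_nonneg (hA : IsPickands A) {z : ℝ} (hz : z ∈ Ioo (0 : ℝ) 1) : 0 ≤ K A z := by
  have h1 := hA.neg_one_le_D hz
  have h3 := (hA.2 z ⟨hz.1.le, hz.2.le⟩).1
  have h4 := mul_le_mul_of_nonneg_left h1 (sub_nonneg.2 hz.2.le)
  simp only [K]
  linarith [le_max_left (1 - z) z]

lemma D_right_cont (hA : IsPickands A) {z : ℝ} (hz : z ∈ Ioo (0 : ℝ) 1) :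
    ContinuousWithinAt (D A) (Ici z) z := by
  have hz' : Ioo (0 : ℝ) 1 ∈ 𝓝 z := Ioo_mem_nhds hz.1 hz.2
  have hc : ContinuousAt A z :=
    (hA.continuousOn.mono Ioo_subset_Icc_self).continuousAt hz'
  refine tendsto_order.2 ⟨fun a ha => ?_, fun a ha => ?_⟩
  · filter_upwards [self_mem_nhdsWithin, mem_nhdsWithin_of_mem_nhds hz'] with w hw hw'
    exact ha.trans_le (hA.D_mono hz hw' hw)
  · have hs := (hasDerivWithinAt_iff_tendsto_slope' (by simp)).1 (hA.hasDeriv hz)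
    have := ((tendsto_order.1 hs).2 a ha).and
      ((mem_nhdsWithin_of_mem_nhds hz' : Ioo (0 : ℝ) 1 ∈ 𝓝[>] z))
    obtain ⟨v, ⟨hv1, hv2⟩, hv3⟩ := (this.and self_mem_nhdsWithin).exists
    have hzv : z < v := hv3
    have hcs : ContinuousAt (fun w => (A v - A w) / (v - w)) z :=
      (continuousAt_const.sub hc).div (by fun_prop) (by linarith)
    rw [slope_def_field] at hv1
    filter_upwards [mem_nhdsWithin_of_mem_nhds hz',
      mem_nhdsWithin_of_mem_nhds ((tendsto_order.1 hcs).2 a hv1),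
      mem_nhdsWithin_of_mem_nhds (Iio_mem_nhds hzv)] with w hw hw1 hw2
    refine lt_of_le_of_lt ?_ hw1
    rw [le_div_iff₀ (sub_pos.2 hw2)]
    exact hA.D_le_slope hw hv2.2.le hw2

lemma K_right_cont (hA : IsPickands A) {z : ℝ} (hz : z ∈ Ioo (0 : ℝ) 1) :
    ContinuousWithinAt (K A) (Ici z) z := by
  have hc : ContinuousAt A z :=
    (hA.continuousOn.mono Ioo_subset_Icc_self).continuousAt (Ioo_mem_nhds hz.1 hz.2)
  exact hc.continuousWithinAt.add
    (ContinuousWithinAt.mul (by fun_prop) (hA.D_right_cont hz))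

/-- The argument of the Pickands function. -/
noncomputable def Z (x y : ℝ) : ℝ := Real.log x / Real.log (x * y)

lemma Z_eq {x y : ℝ} (hx : 0 < x) (hy : 0 < y) :
    Z x y = Real.log x / (Real.log x + Real.log y) := by
  rw [Z, Real.log_mul hx.ne' hy.ne']

lemma Z_mem {x y : ℝ} (hx : x ∈ Ioo (0 : ℝ) 1) (hy : y ∈ Ioo (0 : ℝ) 1) :
    Z x y ∈ Ioo (0 : ℝ) 1 := by
  have h1 := Real.log_neg hx.1 hx.2
  have h2 := Real.log_neg hy.1 hy.2
  rw [Z_eq hx.1 hy.1]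
  refine ⟨div_pos_of_neg_of_neg h1 (by linarith), ?_⟩
  rw [div_lt_one_of_neg (by linarith)]; linarith

lemma Z_mono {x y y' : ℝ} (hx : x ∈ Ioo (0 : ℝ) 1) (hy : y ∈ Ioo (0 : ℝ) 1)
    (hy' : y' ∈ Ioo (0 : ℝ) 1) (h : y ≤ y') : Z x y ≤ Z x y' := by
  have h1 := Real.log_neg hx.1 hx.2
  have h2 := Real.log_neg hy.1 hy.2
  have h3 := Real.log_neg hy'.1 hy'.2
  have h4 := Real.log_le_log hy.1 h
  rw [Z_eq hx.1 hy.1, Z_eq hx.1 hy'.1, ← neg_div_neg_eq, ← neg_div_neg_eq (Real.log x)]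
  exact div_le_div_of_nonneg_left (by linarith) (by linarith) (by linarith)

lemma copula_exp {x y : ℝ} (hx : 0 < x) (hy : 0 < y) :
    evCopula A x y = Real.exp (Real.log (x * y) * A (Z x y)) := by
  rw [evCopula, Real.rpow_def_of_pos (mul_pos hx hy), Z]

lemma copula_mono (hA : IsPickands A) {x y y' : ℝ} (hx : x ∈ Ioo (0 : ℝ) 1)
    (hy : y ∈ Ioo (0 : ℝ) 1) (hy' : y' ∈ Ioo (0 : ℝ) 1) (h : y ≤ y') :
    evCopula A x y ≤ evCopula A x y' := by
  rw [copula_exp hx.1 hy.1, copula_exp hx.1 hy'.1]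
  apply Real.exp_le_exp.2
  have hz := Z_mem hx hy
  have hw := Z_mem hx hy'
  have hzw := Z_mono hx hy hy' h
  have h1 := Real.log_neg hx.1 hx.2
  have e1 : Real.log (x * y) = Real.log x / Z x y := by
    rw [Z, div_div_cancel₀ h1.ne]
  have e2 : Real.log (x * y') = Real.log x / Z x y' := by
    rw [Z, div_div_cancel₀ h1.ne]
  rw [e1, e2]
  generalize Z x y = z at *
  generalize Z x y' = w at *
  have hz1 := (hA.2 z ⟨hz.1.le, hz.2.le⟩).1
  have hle : A w * z ≤ A z * w := by
    have hzz : z ≤ A z := (le_max_right _ _).trans hz1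
    have hpos : 0 < 1 - z := by linarith [hz.2]
    have hcv := hA.1.2
    have := hcv (show z ∈ Icc (0 : ℝ) 1 from ⟨hz.1.le, hz.2.le⟩)
      (show (1 : ℝ) ∈ Icc (0 : ℝ) 1 by simp)
      (show 0 ≤ (1 - w) / (1 - z) from div_nonneg (by linarith [hw.2]) hpos.le)
      (show 0 ≤ (w - z) / (1 - z) from div_nonneg (by linarith) hpos.le)
      (by field_simp; ring)
    simp only [smul_eq_mul, hA.at_one] at this
    have e : (1 - w) / (1 - z) * z + (w - z) / (1 - z) * 1 = w := by field_simp; ring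
    rw [e] at this
    have h2 : A w * (1 - z) ≤ (1 - w) * A z + (w - z) := by
      have h5 : (1 - w) / (1 - z) * A z + (w - z) / (1 - z) * 1
        = ((1 - w) * A z + (w - z)) / (1 - z) := by ring
      rwa [h5, le_div_iff₀ hpos] at this
    have h6 : 0 ≤ (w - z) * (A z - z) := mul_nonneg (by linarith) (by linarith)
    have h7 := mul_le_mul_of_nonneg_right h2 hz.1.le
    nlinarith
  rw [div_mul_eq_mul_div, div_mul_eq_mul_div, div_le_div_iff₀ hz.1 hw.1]
  nlinarith

lemma copula_nonneg {x y : ℝ} (hx : 0 ≤ x) (hy : 0 ≤ y) : 0 ≤ evCopula A x y :=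
  Real.rpow_nonneg (mul_nonneg hx hy) _

lemma copula_le_left (hA : IsPickands A) {x y : ℝ} (hx : x ∈ Ioo (0 : ℝ) 1)
    (hy : y ∈ Ioo (0 : ℝ) 1) : evCopula A x y ≤ x := by
  have h1 := Real.log_neg hx.1 hx.2
  have h2 := Real.log_neg hy.1 hy.2
  have hz := Z_mem hx hy
  have h3 := (le_max_right _ _).trans (hA.2 _ ⟨hz.1.le, hz.2.le⟩).1
  have hl : Real.log (x * y) < 0 := by rw [Real.log_mul hx.1.ne' hy.1.ne']; linarith
  have h4 : Real.log (x * y) * Z x y = Real.log x := by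
    rw [Z, mul_div_cancel₀ _ hl.ne]
  rw [copula_exp hx.1 hy.1]
  nth_rw 3 [← Real.exp_log hx.1]
  apply Real.exp_le_exp.2
  nlinarith

lemma copula_le_right (hA : IsPickands A) {x y : ℝ} (hx : x ∈ Ioo (0 : ℝ) 1)
    (hy : y ∈ Ioo (0 : ℝ) 1) : evCopula A x y ≤ y := by
  have h1 := Real.log_neg hx.1 hx.2
  have h2 := Real.log_neg hy.1 hy.2
  have hz := Z_mem hx hy
  have h3 := (le_max_left _ _).trans (hA.2 _ ⟨hz.1.le, hz.2.le⟩).1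
  have hl : Real.log (x * y) < 0 := by rw [Real.log_mul hx.1.ne' hy.1.ne']; linarith
  have h4 : Real.log (x * y) * Z x y = Real.log x := by
    rw [Z, mul_div_cancel₀ _ hl.ne]
  have h5 := Real.log_mul hx.1.ne' hy.1.ne'
  rw [copula_exp hx.1 hy.1]
  nth_rw 3 [← Real.exp_log hy.1]
  apply Real.exp_le_exp.2
  nlinarith

/-- Conditional distribution function of the second coordinate given the first. -/
noncomputable def F (A : ℝ → ℝ) (x y : ℝ) : ℝ :=
  if y ≤ 0 then 0 else if 1 ≤ y then 1 else x⁻¹ * (evCopula A x y * K A (Z x y))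

lemma F_nonneg (hA : IsPickands A) {x : ℝ} (hx : x ∈ Ioo (0 : ℝ) 1) (y : ℝ) : 0 ≤ F A x y := by
  unfold F
  split_ifs with h h'
  · exact le_rfl
  · exact zero_le_one
  · push Not at h h'
    exact mul_nonneg (inv_nonneg.2 hx.1.le) (mul_nonneg (copula_nonneg hx.1.le h.le)
      (hA.K_nonneg (Z_mem hx ⟨h, h'⟩)))

lemma F_le_one (hA : IsPickands A) {x : ℝ} (hx : x ∈ Ioo (0 : ℝ) 1) (y : ℝ) : F A x y ≤ 1 := by
  unfold F
  split_ifs with h h'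
  · exact zero_le_one
  · exact le_rfl
  · push Not at h h'
    have h1 := hA.K_le_one (Z_mem hx ⟨h, h'⟩)
    have h2 := hA.copula_le_left hx ⟨h, h'⟩
    have h3 := copula_nonneg (A := A) hx.1.le h.le
    rw [inv_mul_le_iff₀ hx.1]
    nlinarith

lemma F_mono (hA : IsPickands A) {x : ℝ} (hx : x ∈ Ioo (0 : ℝ) 1) : Monotone (F A x) := by
  intro y y' h
  by_cases h1 : y ≤ 0
  · have : F A x y = 0 := by simp [F, h1]
    rw [this]; exact hA.F_nonneg hx y'
  by_cases h2 : 1 ≤ y'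
  · have : F A x y' = 1 := by
      have : ¬ y' ≤ 0 := by linarith
      simp [F, h2, this]
    rw [this]; exact hA.F_le_one hx y
  push Not at h1 h2
  have hy : y ∈ Ioo (0 : ℝ) 1 := ⟨h1, by linarith⟩
  have hy' : y' ∈ Ioo (0 : ℝ) 1 := ⟨by linarith, h2⟩
  simp only [F, not_le.2 hy.1, not_le.2 hy.2, not_le.2 hy'.1, not_le.2 hy'.2, if_false]
  exact mul_le_mul_of_nonneg_left (mul_le_mul (hA.copula_mono hx hy hy' h)
    (hA.K_mono (Z_mem hx hy) (Z_mem hx hy') (Z_mono hx hy hy' h))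
    (hA.K_nonneg (Z_mem hx hy)) (copula_nonneg hx.1.le hy'.1.le)) (inv_nonneg.2 hx.1.le)

lemma F_right_cont (hA : IsPickands A) {x : ℝ} (hx : x ∈ Ioo (0 : ℝ) 1) (y : ℝ) :
    ContinuousWithinAt (F A x) (Ici y) y := by
  rcases lt_trichotomy y 0 with h | rfl | h
  · have : F A x =ᶠ[𝓝 y] fun _ => 0 := by
      filter_upwards [Iio_mem_nhds h] with w hw
      simp [F, (le_of_lt hw : w ≤ 0)]
    exact (continuousAt_const.congr this.symm).continuousWithinAt
  · have h0 : F A x 0 = 0 := by simp [F]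
    have hb : Tendsto (fun w : ℝ => x⁻¹ * w) (𝓝[≥] 0) (𝓝 0) := by
      have : Tendsto (fun w : ℝ => x⁻¹ * w) (𝓝 0) (𝓝 (x⁻¹ * 0)) :=
        Continuous.tendsto (by fun_prop) 0
      rw [mul_zero] at this
      exact this.mono_left nhdsWithin_le_nhds
    unfold ContinuousWithinAt
    rw [h0]
    refine tendsto_of_tendsto_of_tendsto_of_le_of_le' tendsto_const_nhds hb
      (Eventually.of_forall fun w => hA.F_nonneg hx w) ?_
    filter_upwards [self_mem_nhdsWithin,
      mem_nhdsWithin_of_mem_nhds (Iio_mem_nhds (zero_lt_one' ℝ))] with w hw hw1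
    rcases eq_or_lt_of_le (show (0 : ℝ) ≤ w from hw) with h | h
    · rw [← h, h0, mul_zero]
    · have hw' : w ∈ Ioo (0 : ℝ) 1 := ⟨h, hw1⟩
      simp only [F, not_le.2 hw'.1, not_le.2 hw'.2, if_false]
      refine mul_le_mul_of_nonneg_left ?_ (inv_nonneg.2 hx.1.le)
      have h1 := hA.K_le_one (Z_mem hx hw')
      have h2 := hA.copula_le_right hx hw'
      have h3 := copula_nonneg (A := A) hx.1.le h.le
      nlinarith
  · rcases lt_or_ge y 1 with h1 | h1
    · have hy : y ∈ Ioo (0 : ℝ) 1 := ⟨h, h1⟩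
      have hev : (fun w => x⁻¹ * (Real.exp (Real.log (x * w) * A (Z x w)) * K A (Z x w)))
          =ᶠ[𝓝 y] F A x := by
        filter_upwards [Ioo_mem_nhds h h1] with w hw
        simp only [F, not_le.2 hw.1, not_le.2 hw.2, if_false, copula_exp hx.1 hw.1]
      have hlog : ContinuousAt (fun w => Real.log (x * w)) y :=
        ContinuousAt.log (by fun_prop) (mul_pos hx.1 h).ne'
      have hl : Real.log (x * y) ≠ 0 := by
        rw [Real.log_mul hx.1.ne' h.ne']
        linarith [Real.log_neg hx.1 hx.2, Real.log_neg h h1]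
      have hZ : ContinuousAt (Z x) y := continuousAt_const.div hlog hl
      have hz := Z_mem hx hy
      have hAc : ContinuousAt A (Z x y) :=
        (hA.continuousOn.mono Ioo_subset_Icc_self).continuousAt (Ioo_mem_nhds hz.1 hz.2)
      have hK : ContinuousWithinAt (fun w => K A (Z x w)) (Ici y) y := by
        have ht : Tendsto (Z x) (𝓝[≥] y) (𝓝[≥] (Z x y)) := by
          refine tendsto_nhdsWithin_of_tendsto_nhds_of_eventually_within _
            (hZ.tendsto.mono_left nhdsWithin_le_nhds) ?_
          filter_upwards [self_mem_nhdsWithin,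
            mem_nhdsWithin_of_mem_nhds (Ioo_mem_nhds h h1)] with w hw hw'
          exact Z_mono hx hy hw' hw
        exact (hA.K_right_cont hz).tendsto.comp ht
      have hE : ContinuousAt (fun w => Real.exp (Real.log (x * w) * A (Z x w))) y :=
        (hlog.mul (ContinuousAt.comp (f := Z x) hAc hZ)).rexp
      have := (continuousWithinAt_const (b := x⁻¹) (s := Ici y) (x := y)).mul
        (hE.continuousWithinAt.mul hK)
      exact this.congr_of_eventuallyEq (hev.symm.filter_mono nhdsWithin_le_nhds) hev.symm.self_of_nhds
    · have h1' : ∀ w ∈ Ici y, F A x w = 1 := by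
        intro w hw
        have hw' : y ≤ w := hw
        simp [F, not_le.2 (by linarith : 0 < w), h1.trans hw']
      exact continuousWithinAt_const.congr h1' (h1' y self_mem_Ici)


lemma copula_continuousOn (hA : IsPickands A) {y : ℝ} (hy : y ∈ Ioo (0 : ℝ) 1) :
    ContinuousOn (fun x => evCopula A x y) (Icc 0 1) := by
  intro x hx
  rcases eq_or_lt_of_le hx.1 with h | h
  · subst h
    have hid : Tendsto (fun w : ℝ => w) (𝓝[Icc 0 1] 0) (𝓝 0) := nhdsWithin_le_nhds
    unfold ContinuousWithinAt
    beta_reduce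
    rw [hA.copula_zero_left]
    refine tendsto_of_tendsto_of_tendsto_of_le_of_le' tendsto_const_nhds hid ?_ ?_
    · filter_upwards [self_mem_nhdsWithin] with w hw using copula_nonneg hw.1 hy.1.le
    · filter_upwards [self_mem_nhdsWithin] with w hw
      rcases eq_or_lt_of_le hw.1 with h | h
      · rw [← h, hA.copula_zero_left]
      rcases eq_or_lt_of_le hw.2 with h' | h'
      · rw [h', hA.copula_one_left]; exact hy.2.le
      · exact hA.copula_le_left ⟨h, h'⟩ hy
  · have hl : Real.log (x * y) ≠ 0 := by
      rw [Real.log_mul h.ne' hy.1.ne']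
      linarith [Real.log_nonpos hx.1 hx.2, Real.log_neg hy.1 hy.2]
    have hlog : ContinuousAt (fun w => Real.log (w * y)) x :=
      ContinuousAt.log (by fun_prop) (mul_pos h hy.1).ne'
    have hZ : ContinuousAt (fun w => Z w y) x := (Real.continuousAt_log h.ne').div hlog hl
    have hmem : ∀ w ∈ Ioc (0 : ℝ) 1, Z w y ∈ Icc (0 : ℝ) 1 := by
      intro w hw
      rcases eq_or_lt_of_le hw.2 with h' | h'
      · simp [Z, h']
      · exact Ioo_subset_Icc_self (Z_mem ⟨hw.1, h'⟩ hy)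
    have hev : ∀ᶠ w in 𝓝[Icc 0 1] x, w ∈ Ioc (0 : ℝ) 1 := by
      filter_upwards [self_mem_nhdsWithin, mem_nhdsWithin_of_mem_nhds (Ioi_mem_nhds h)]
        with w hw hw' using ⟨hw', hw.2⟩
    have ht : Tendsto (fun w => Z w y) (𝓝[Icc 0 1] x) (𝓝[Icc 0 1] (Z x y)) :=
      tendsto_nhdsWithin_of_tendsto_nhds_of_eventually_within _
        (hZ.tendsto.mono_left nhdsWithin_le_nhds) (hev.mono hmem)
    have hAZ : ContinuousWithinAt (fun w => A (Z w y)) (Icc 0 1) x :=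
      (hA.continuousOn _ (hmem x ⟨h, hx.2⟩)).tendsto.comp ht
    have := (hlog.continuousWithinAt.mul hAZ).rexp
    refine this.congr_of_eventuallyEq ?_ (copula_exp h hy.1)
    filter_upwards [hev] with w hw using copula_exp hw.1 hy.1

lemma copula_hasDeriv (hA : IsPickands A) {x y : ℝ} (hx : x ∈ Ioo (0 : ℝ) 1)
    (hy : y ∈ Ioo (0 : ℝ) 1) :
    HasDerivWithinAt (fun x => evCopula A x y) (F A x y) (Iio x) x := by
  have hl : Real.log (x * y) ≠ 0 := by
    rw [Real.log_mul hx.1.ne' hy.1.ne']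
    linarith [Real.log_neg hx.1 hx.2, Real.log_neg hy.1 hy.2]
  have hl' : Real.log x + Real.log y ≠ 0 := by
    linarith [Real.log_neg hx.1 hx.2, Real.log_neg hy.1 hy.2]
  have hz := Z_mem hx hy
  have hlog : HasDerivAt (fun w => Real.log (w * y)) x⁻¹ x := by
    have h1 := hx.1.ne'
    have h2 := hy.1.ne'
    have := ((hasDerivAt_id' x).mul_const y).log (mul_pos hx.1 hy.1).ne'
    refine this.congr_deriv ?_
    field_simp
  have hZ : HasDerivAt (fun w => Z w y)
      ((x⁻¹ * Real.log (x * y) - Real.log x * x⁻¹) / Real.log (x * y) ^ 2) x :=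
    (Real.hasDerivAt_log hx.1.ne').div hlog hl
  have hmaps : MapsTo (fun w => Z w y) (Ioo 0 x) (Ioi (Z x y)) := by
    intro w hw
    have hw1 : w < 1 := hw.2.trans hx.2
    have h1 := Real.log_neg hw.1 hw1
    have h2 := Real.log_neg hy.1 hy.2
    have h3 := Real.log_neg hx.1 hx.2
    have h4 := Real.log_lt_log hw.1 hw.2
    simp only [mem_Ioi]
    rw [Z_eq hx.1 hy.1, Z_eq hw.1 hy.1, ← neg_div_neg_eq, ← neg_div_neg_eq (Real.log w),
      div_lt_div_iff₀ (by linarith) (by linarith)]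
    nlinarith
  have hAZ := (hA.hasDeriv hz).comp x (hZ.hasDerivWithinAt (s := Ioo 0 x)) hmaps
  have hC := ((hlog.hasDerivWithinAt (s := Ioo 0 x)).mul hAZ).exp
  have hC' : HasDerivWithinAt (fun x => evCopula A x y) (F A x y) (Ioo 0 x) x := by
    refine HasDerivWithinAt.congr_deriv (hC.congr (fun w hw => ?_) ?_) ?_
    · exact copula_exp hw.1 hy.1
    · exact copula_exp hx.1 hy.1
    · simp only [F, not_le.2 hy.1, not_le.2 hy.2, if_false, copula_exp hx.1 hy.1,
        Function.comp, Pi.mul_apply]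
      have e : Real.log (x * y) * (D A (Z x y) *
          ((x⁻¹ * Real.log (x * y) - Real.log x * x⁻¹) / Real.log (x * y) ^ 2))
          = x⁻¹ * ((1 - Z x y) * D A (Z x y)) := by
        rw [Z]; field_simp
      rw [e, K]; ring
  exact hC'.mono_of_mem_nhdsWithin (Ioo_mem_nhdsLT hx.1)

/-- A point of the open unit interval, equal to the argument if that lies there. -/
noncomputable def clip (x : ℝ) : ℝ := if x ∈ Ioo (0 : ℝ) 1 then x else 1 / 2

lemma clip_mem (x : ℝ) : clip x ∈ Ioo (0 : ℝ) 1 := by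
  unfold clip
  split_ifs with h
  · exact h
  · norm_num

lemma measurable_clip : Measurable clip :=
  Measurable.ite measurableSet_Ioo measurable_id measurable_const

lemma F_measurable (hA : IsPickands A) (y : ℝ) : Measurable fun x => F A (clip x) y := by
  by_cases h : y ≤ 0
  · simp [F, h]
  by_cases h' : 1 ≤ y
  · simp [F, h, h']
  push Not at h h'
  have hc := measurable_clip
  have hZ : Measurable fun x => Z (clip x) y := by unfold Z; fun_prop
  have hA' : Measurable ((Icc (0 : ℝ) 1).piecewise A 0) :=
    hA.continuousOn.measurable_piecewise continuousOn_const measurableSet_Icc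
  have hAZ : Measurable fun x => A (Z (clip x) y) := by
    have : (fun x => A (Z (clip x) y)) = (Icc (0 : ℝ) 1).piecewise A 0 ∘ fun x => Z (clip x) y := by
      funext x
      have := Ioo_subset_Icc_self (Z_mem (clip_mem x) ⟨h, h'⟩)
      simp only [Function.comp, Set.piecewise_eq_of_mem _ _ _ this]
    rw [this]
    exact hA'.comp hZ
  have hD : Measurable fun x => D A (Z (clip x) y) := (measurable_derivWithin_Ioi A).comp hZ
  simp only [F, not_le.2 h, not_le.2 h', if_false, K]
  have hC : Measurable fun x => evCopula A (clip x) y := by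
    have : (fun x => evCopula A (clip x) y) =
        fun x => (clip x * y) ^ A (Z (clip x) y) := rfl
    rw [this]
    exact (hc.mul_const y).pow hAZ
  exact hc.inv.mul (hC.mul (hAZ.add ((measurable_const.sub hZ).mul hD)))

lemma integral_F (hA : IsPickands A) {a y : ℝ} (ha : a ∈ Icc (0 : ℝ) 1)
    (hy : y ∈ Icc (0 : ℝ) 1) :
    ∫⁻ x in Ioo 0 a, ENNReal.ofReal (F A (clip x) y) = ENNReal.ofReal (evCopula A a y) := by
  rcases eq_or_lt_of_le hy.1 with h | h
  · subst h
    simp [F, hA.copula_zero_right]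
  rcases eq_or_lt_of_le hy.2 with h' | h'
  · subst h'
    have h10 : ¬ (1 : ℝ) ≤ 0 := by norm_num
    simp [F, hA.copula_one_right ha, h10]
  have hint : Integrable (fun x => F A (clip x) y) (volume.restrict (Ioo 0 a)) := by
    refine Integrable.of_bound (C := 1) (hA.F_measurable y).aestronglyMeasurable ?_
    refine Eventually.of_forall fun x => ?_
    rw [Real.norm_of_nonneg (hA.F_nonneg (clip_mem x) y)]
    exact hA.F_le_one (clip_mem x) y
  rw [← ofReal_integral_eq_lintegral_ofReal hint
    (Eventually.of_forall fun x => hA.F_nonneg (clip_mem x) y)]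
  congr 1
  rw [← integral_Ioc_eq_integral_Ioo, ← intervalIntegral.integral_of_le ha.1]
  have hint' : IntervalIntegrable (fun x => F A (clip x) y) volume 0 a := by
    rw [intervalIntegrable_iff_integrableOn_Ioo_of_le ha.1]
    exact hint
  have hrefl : ∫ x in (-a)..(-0), F A (clip (-x)) y = ∫ x in 0..a, F A (clip x) y :=
    (intervalIntegral.integral_comp_neg fun x => F A (clip x) y).trans (by simp)
  have hmain : ∫ x in (-a)..(-0), -F A (clip (-x)) y
      = evCopula A (- -0) y - evCopula A (- -a) y := by
    refine intervalIntegral.integral_eq_sub_of_hasDeriv_right_of_le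
      (f := fun x => evCopula A (-x) y) (by linarith [ha.1]) ?_ ?_ ?_
    · refine (hA.copula_continuousOn ⟨h, h'⟩).comp continuousOn_neg fun x hx => ?_
      exact ⟨by linarith [hx.2], by linarith [hx.1, ha.2]⟩
    · intro x hx
      have hx' : -x ∈ Ioo (0 : ℝ) 1 := ⟨by linarith [hx.2], by linarith [hx.1, ha.2]⟩
      have hd := hA.copula_hasDeriv hx' ⟨h, h'⟩
      have := hd.scomp x ((hasDerivAt_neg x).hasDerivWithinAt (s := Ioi x))
        (fun w hw => by simpa using hw)
      have hcl : clip (-x) = -x := by rw [clip, if_pos hx']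
      rw [hcl]
      rw [neg_one_smul] at this
      exact this
    · have := (hint'.comp_sub_left 0).symm.neg
      simp only [zero_sub, sub_zero] at this
      rw [neg_zero]
      exact this
  rw [intervalIntegral.integral_neg, hrefl] at hmain
  simp only [neg_zero, neg_neg, hA.copula_zero_left] at hmain
  linarith

/-- The conditional distribution of the second coordinate given the first. -/
noncomputable def stieltjes (hA : IsPickands A) (x : ℝ) : StieltjesFunction ℝ where
  toFun := F A (clip x)
  mono' := hA.F_mono (clip_mem x)
  right_continuous' := hA.F_right_cont (clip_mem x)

lemma stieltjes_Icc (hA : IsPickands A) (x y : ℝ) :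
    (hA.stieltjes x).measure (Icc 0 y) = ENNReal.ofReal (F A (clip x) y) := by
  have : Function.leftLim (hA.stieltjes x) 0 = 0 := by
    refine leftLim_eq_of_tendsto ?_
    refine tendsto_const_nhds.congr' ?_
    filter_upwards [self_mem_nhdsWithin] with w hw
    have : w ≤ 0 := le_of_lt hw
    change 0 = F A (clip x) w
    simp [F, this]
  rw [StieltjesFunction.measure_Icc, this, sub_zero]
  rfl

lemma stieltjes_atBot (hA : IsPickands A) (x : ℝ) : Tendsto (hA.stieltjes x) atBot (𝓝 0) := by
  refine tendsto_const_nhds.congr' ?_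
  filter_upwards [eventually_le_atBot 0] with w hw
  change 0 = F A (clip x) w
  simp [F, hw]

lemma stieltjes_atTop (hA : IsPickands A) (x : ℝ) : Tendsto (hA.stieltjes x) atTop (𝓝 1) := by
  refine tendsto_const_nhds.congr' ?_
  filter_upwards [eventually_ge_atTop 1] with w hw
  change 1 = F A (clip x) w
  simp [F, hw, not_le.2 (zero_lt_one.trans_le hw)]

/-- The extreme-value copula of a Pickands function has a doubly stochastic measure. -/
theorem exists_measure (hA : IsPickands A) : ∃ μ, IsCopulaMeasure (evCopula A) μ := by
  have hprob : ∀ x, IsProbabilityMeasure (hA.stieltjes x).measure := fun x =>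
    StieltjesFunction.isProbabilityMeasure _ (hA.stieltjes_atBot x) (hA.stieltjes_atTop x)
  have hmeas : Measurable fun x => (hA.stieltjes x).measure := by
    refine .measure_of_isPiSystem_of_isProbabilityMeasure (borel_eq_generateFrom_Iic ℝ)
      isPiSystem_Iic ?_
    rintro _ ⟨y, rfl⟩
    have : ∀ x, (hA.stieltjes x).measure (Iic y) = ENNReal.ofReal (F A (clip x) y) := fun x => by
      rw [StieltjesFunction.measure_Iic _ (hA.stieltjes_atBot x), sub_zero]
      rfl
    simp_rw [this]
    exact (hA.F_measurable y).ennreal_ofReal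
  let κ : Kernel ℝ ℝ := ⟨fun x => (hA.stieltjes x).measure, hmeas⟩
  have hκ : IsMarkovKernel κ := ⟨hprob⟩
  let ν : Measure ℝ := volume.restrict (Icc 0 1)
  have hν : IsProbabilityMeasure ν := ⟨by simp [ν]⟩
  have hIic : ∀ x y, (hA.stieltjes x).measure (Iic y) = ENNReal.ofReal (F A (clip x) y) :=
    fun x y => by
      rw [StieltjesFunction.measure_Iic _ (hA.stieltjes_atBot x), sub_zero]
      rfl
  have hrect : ∀ x ∈ Icc (0 : ℝ) 1, ∀ y ∈ Icc (0 : ℝ) 1,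
      (ν ⊗ₘ κ) (Icc 0 x ×ˢ Icc 0 y) = ENNReal.ofReal (evCopula A x y) := by
    intro x hx y hy
    rw [Measure.compProd_apply_prod measurableSet_Icc measurableSet_Icc,
      Measure.restrict_restrict measurableSet_Icc,
      inter_eq_left.2 (Icc_subset_Icc_right hx.2), ← hA.integral_F hx hy,
      restrict_Ioo_eq_restrict_Icc]
    exact lintegral_congr fun w => hA.stieltjes_Icc w y
  refine ⟨ν ⊗ₘ κ, inferInstance, Measure.fst_compProd ν κ, ?_, hrect⟩
  refine Measure.ext_of_Iic _ _ fun y => ?_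
  have hpre : Prod.snd ⁻¹' Iic y = (univ : Set ℝ) ×ˢ Iic y := by ext; simp
  have hκy : ∀ x, κ x (Iic y) = ENNReal.ofReal (F A (clip x) y) := fun x => hIic x y
  rw [Measure.map_apply measurable_snd measurableSet_Iic, hpre,
    Measure.compProd_apply_prod MeasurableSet.univ measurableSet_Iic, Measure.restrict_univ,
    Measure.restrict_apply measurableSet_Iic]
  simp_rw [hκy]
  rcases lt_or_ge y 0 with h | h
  · have : Iic y ∩ Icc (0 : ℝ) 1 = ∅ := by
      ext w; simp only [mem_inter_iff, mem_Iic, mem_Icc, mem_empty_iff_false, iff_false]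
      intro hw; linarith [hw.1, hw.2.1]
    simp [F, h.le, this]
  rcases le_or_gt y 1 with h' | h'
  · have e : Iic y ∩ Icc (0 : ℝ) 1 = Icc 0 y := by
      ext w; simp only [mem_inter_iff, mem_Iic, mem_Icc]
      exact ⟨fun hw => ⟨hw.2.1, hw.1⟩, fun hw => ⟨hw.2, hw.1, hw.2.trans h'⟩⟩
    have := hA.integral_F (a := 1) (y := y) (by simp) ⟨h, h'⟩
    rw [restrict_Ioo_eq_restrict_Icc, hA.copula_one_left] at this
    rw [e, Real.volume_Icc, sub_zero, ← this]
  · have e : Iic y ∩ Icc (0 : ℝ) 1 = Icc 0 1 :=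
      inter_eq_right.2 fun w hw => hw.2.trans h'.le
    simp [F, not_le.2 (zero_lt_one.trans h'), h'.le, e, ν]

/-- `copulaMeasure (evCopula A)` is the doubly stochastic measure of `evCopula A`. -/
theorem isCopulaMeasure (hA : IsPickands A) :
    IsCopulaMeasure (evCopula A) (copulaMeasure (evCopula A)) :=
  Classical.epsilon_spec hA.exists_measure

end IsPickands

open scoped ENNReal

/-! ### Change of variables on the unit square -/

/-- The derivative of `(z, r) ↦ (exp (-(r z)), exp (-(r (1 - z))))`. -/
noncomputable def expChartDeriv (q : ℝ × ℝ) : ℝ × ℝ →L[ℝ] ℝ × ℝ :=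
  (Matrix.toLin (.finTwoProd ℝ) (.finTwoProd ℝ)
    !![-q.2 * Real.exp (-(q.2 * q.1)), -q.1 * Real.exp (-(q.2 * q.1));
       q.2 * Real.exp (-(q.2 * (1 - q.1))),
       -(1 - q.1) * Real.exp (-(q.2 * (1 - q.1)))]).toContinuousLinearMap

lemma hasFDerivAt_expChart (q : ℝ × ℝ) :
    HasFDerivAt (fun q : ℝ × ℝ => (Real.exp (-(q.2 * q.1)), Real.exp (-(q.2 * (1 - q.1)))))
      (expChartDeriv q) q := by
  unfold expChartDeriv
  rw [Matrix.toLin_finTwoProd_toContinuousLinearMap]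
  have h1 : HasFDerivAt (fun q : ℝ × ℝ => q.1) (ContinuousLinearMap.fst ℝ ℝ ℝ) q := hasFDerivAt_fst
  have h2 : HasFDerivAt (fun q : ℝ × ℝ => q.2) (ContinuousLinearMap.snd ℝ ℝ ℝ) q := hasFDerivAt_snd
  refine HasFDerivAt.prodMk ((h2.mul h1).neg.exp.congr_fderiv ?_)
    ((h2.mul (h1.const_sub 1)).neg.exp.congr_fderiv ?_) <;>
  · ext <;> simp <;> ring

/-- The two exponentials multiply to `exp (-r)` and the polynomial factor is `r (1 - z) + r z`, so
the Jacobian depends on `r` only. -/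
lemma det_expChartDeriv (q : ℝ × ℝ) : (expChartDeriv q).det = q.2 * Real.exp (-q.2) := by
  unfold expChartDeriv
  simp only [LinearMap.det_toContinuousLinearMap, LinearMap.det_toLin,
    Matrix.det_fin_two_of]
  have : Real.exp (-q.2) = Real.exp (-(q.2 * q.1)) * Real.exp (-(q.2 * (1 - q.1))) := by
    rw [← Real.exp_add]; congr 1; ring
  rw [this]; ring

lemma expChart_image :
    (fun q : ℝ × ℝ => (Real.exp (-(q.2 * q.1)), Real.exp (-(q.2 * (1 - q.1))))) ''
      (Ioo 0 1 ×ˢ Ioi 0) = Ioo (0 : ℝ) 1 ×ˢ Ioo (0 : ℝ) 1 := by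
  ext ⟨x, y⟩
  simp only [mem_image, mem_prod, Prod.exists, mem_Ioi, Prod.mk.injEq]
  constructor
  · rintro ⟨z, r, ⟨hz, hr⟩, rfl, rfl⟩
    have h1 := mul_pos hr hz.1
    have h2 := mul_pos hr (sub_pos.2 hz.2)
    exact ⟨⟨Real.exp_pos _, (Real.exp_lt_exp.2 (by linarith)).trans_eq Real.exp_zero⟩,
      ⟨Real.exp_pos _, (Real.exp_lt_exp.2 (by linarith)).trans_eq Real.exp_zero⟩⟩
  · rintro ⟨hx, hy⟩
    have h1 := Real.log_neg hx.1 hx.2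
    have h2 := Real.log_neg hy.1 hy.2
    have hne : Real.log x + Real.log y ≠ 0 := by linarith
    refine ⟨IsPickands.Z x y, -(Real.log x + Real.log y), ⟨IsPickands.Z_mem hx hy, by linarith⟩,
      ?_, ?_⟩
    · rw [IsPickands.Z_eq hx.1 hy.1]
      have : -(-(Real.log x + Real.log y) * (Real.log x / (Real.log x + Real.log y)))
          = Real.log x := by field_simp
      rw [this, Real.exp_log hx.1]
    · rw [IsPickands.Z_eq hx.1 hy.1]
      have : -(-(Real.log x + Real.log y) * (1 - Real.log x / (Real.log x + Real.log y)))
          = Real.log y := by field_simp; ring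
      rw [this, Real.exp_log hy.1]

lemma expChart_injOn :
    InjOn (fun q : ℝ × ℝ => (Real.exp (-(q.2 * q.1)), Real.exp (-(q.2 * (1 - q.1)))))
      (Ioo 0 1 ×ˢ Ioi 0) := by
  rintro ⟨z, r⟩ ⟨-, hr⟩ ⟨w, s⟩ ⟨-, hs⟩ h
  simp only [Prod.mk.injEq, Real.exp_eq_exp] at h ⊢
  have hrs : r = s := by linarith [h.1, h.2]
  subst hrs
  have hr' : (0 : ℝ) < r := hr
  exact ⟨mul_left_cancel₀ hr'.ne' (by linarith [h.1]), rfl⟩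

lemma lintegral_unitSquare (g : ℝ × ℝ → ℝ≥0∞) :
    ∫⁻ p in Ioo (0 : ℝ) 1 ×ˢ Ioo (0 : ℝ) 1, g p =
      ∫⁻ q in Ioo (0 : ℝ) 1 ×ˢ Ioi (0 : ℝ), ENNReal.ofReal (q.2 * Real.exp (-q.2)) *
        g (Real.exp (-(q.2 * q.1)), Real.exp (-(q.2 * (1 - q.1)))) := by
  rw [← expChart_image, lintegral_image_eq_lintegral_abs_det_fderiv_mul volume
    (measurableSet_Ioo.prod measurableSet_Ioi)
    (fun q _ => (hasFDerivAt_expChart q).hasFDerivWithinAt) expChart_injOn]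
  refine setLIntegral_congr_fun (measurableSet_Ioo.prod measurableSet_Ioi) ?_
  rintro q ⟨-, hq⟩
  have hq' : (0 : ℝ) < q.2 := hq
  beta_reduce
  rw [det_expChartDeriv, abs_of_pos (mul_pos hq' (Real.exp_pos _))]

lemma lintegral_id_mul_exp_neg_mul {c : ℝ} (hc : 0 < c) :
    ∫⁻ r in Ioi (0 : ℝ), ENNReal.ofReal (r * Real.exp (-(c * r))) = ENNReal.ofReal (1 / c ^ 2) := by
  have h := Real.integral_rpow_mul_exp_neg_mul_Ioi (a := 2) (r := c) two_pos hc
  have e : ∫ r in Ioi (0 : ℝ), r * Real.exp (-(c * r)) = 1 / c ^ 2 := by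
    have hG : Real.Gamma 2 = 1 := by
      simp
    rw [hG, mul_one] at h
    norm_num at h
    simpa using h
  have hi : IntegrableOn (fun r : ℝ => r * Real.exp (-(c * r))) (Ioi 0) := by
    -- A non-integrable function has Bochner integral 0 by convention, while the computed value is
    -- positive.
    by_contra hn
    rw [integral_undef hn] at e
    have : 0 < 1 / c ^ 2 := by positivity
    linarith
  rw [← e, ofReal_integral_eq_lintegral_ofReal hi]
  filter_upwards [ae_restrict_mem measurableSet_Ioi] with r hr
  exact mul_nonneg (le_of_lt hr) (Real.exp_pos _).le

/-- Integrals over the unit square in the coordinates `(log x / log (x y), -log (x y))`. -/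
lemma lintegral_unitSquare_rpow {c h : ℝ → ℝ} (hc : AEMeasurable c (volume.restrict (Ioo 0 1)))
    (hh : AEMeasurable h (volume.restrict (Ioo 0 1))) (hpos : ∀ z ∈ Ioo (0 : ℝ) 1, 0 < c z) :
    ∫⁻ p in Ioo (0 : ℝ) 1 ×ˢ Ioo (0 : ℝ) 1,
        ENNReal.ofReal ((p.1 * p.2) ^ (c (IsPickands.Z p.1 p.2) - 1) * h (IsPickands.Z p.1 p.2)) =
      ∫⁻ z in Ioo (0 : ℝ) 1, ENNReal.ofReal (1 / c z ^ 2 * h z) := by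
  rw [lintegral_unitSquare]
  -- In the chart `x y = exp (-r)`; the exponent `c - 1` is chosen so that the factor `exp (-r)` of
  -- the Jacobian completes it to `exp (-(c z) r)`.
  have e : ∀ q ∈ Ioo (0 : ℝ) 1 ×ˢ Ioi (0 : ℝ), ENNReal.ofReal (q.2 * Real.exp (-q.2)) *
      ENNReal.ofReal ((Real.exp (-(q.2 * q.1)) * Real.exp (-(q.2 * (1 - q.1)))) ^
        (c (IsPickands.Z (Real.exp (-(q.2 * q.1))) (Real.exp (-(q.2 * (1 - q.1))))) - 1) *
        h (IsPickands.Z (Real.exp (-(q.2 * q.1))) (Real.exp (-(q.2 * (1 - q.1)))))) =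
      ENNReal.ofReal (q.2 * Real.exp (-(c q.1 * q.2)) * h q.1) := by
    rintro ⟨z, r⟩ ⟨hz, hr⟩
    have hr' : (0 : ℝ) < r := hr
    have hZ : IsPickands.Z (Real.exp (-(r * z))) (Real.exp (-(r * (1 - z)))) = z := by
      rw [IsPickands.Z_eq (Real.exp_pos _) (Real.exp_pos _), Real.log_exp, Real.log_exp]
      have : -(r * z) + -(r * (1 - z)) = -r := by ring
      rw [this]; field_simp
    have hE : Real.exp (-(r * z)) * Real.exp (-(r * (1 - z))) = Real.exp (-r) := by
      rw [← Real.exp_add]; congr 1; ring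
    simp only [hZ, hE]
    rw [← ENNReal.ofReal_mul (mul_nonneg hr'.le (Real.exp_pos _).le), ← Real.exp_mul]
    congr 1
    have : Real.exp (-(c z * r)) = Real.exp (-r) * Real.exp (-r * (c z - 1)) := by
      rw [← Real.exp_add]; congr 1; ring
    rw [this]; ring
  rw [setLIntegral_congr_fun (measurableSet_Ioo.prod measurableSet_Ioi) e,
    Measure.volume_eq_prod, ← Measure.prod_restrict, lintegral_prod]
  · refine setLIntegral_congr_fun measurableSet_Ioo fun z hz => ?_
    have e2 : ∀ r ∈ Ioi (0 : ℝ), ENNReal.ofReal (r * Real.exp (-(c z * r)) * h z)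
        = ENNReal.ofReal (r * Real.exp (-(c z * r))) * ENNReal.ofReal (h z) := fun r hr =>
      ENNReal.ofReal_mul (mul_nonneg (le_of_lt hr) (Real.exp_pos _).le)
    rw [setLIntegral_congr_fun measurableSet_Ioi e2, lintegral_mul_const _ (by fun_prop),
      lintegral_id_mul_exp_neg_mul (hpos z hz), ← ENNReal.ofReal_mul (by positivity)]
  · have h1 := hc.comp_fst (ν := volume.restrict (Ioi (0 : ℝ)))
    have h2 := hh.comp_fst (ν := volume.restrict (Ioi (0 : ℝ)))
    have h3 : AEMeasurable (fun q : ℝ × ℝ => q.2)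
      ((volume.restrict (Ioo (0 : ℝ) 1)).prod (volume.restrict (Ioi (0 : ℝ)))) :=
      measurable_snd.aemeasurable
    exact ((h3.mul (h1.mul h3).neg.exp).mul h2).ennreal_ofReal


/-! ### Reflection and measurability -/

namespace IsPickands

variable {A : ℝ → ℝ}

/-- Swapping the coordinates of the copula reflects `A`, so facts about the partial derivative in
`x` transfer to the one in `y`. -/
lemma reflect (hA : IsPickands A) : IsPickands fun t => A (1 - t) := by
  refine ⟨⟨convex_Icc 0 1, fun x hx y hy a b ha hb hab => ?_⟩, fun t ht => ?_⟩
  · have := hA.1.2 (x := 1 - x) ⟨by linarith [hx.2], by linarith [hx.1]⟩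
      (y := 1 - y) ⟨by linarith [hy.2], by linarith [hy.1]⟩ ha hb hab
    simp only [smul_eq_mul] at this ⊢
    have e : 1 - (a * x + b * y) = a * (1 - x) + b * (1 - y) := by linear_combination -hab
    rwa [e]
  · have := hA.2 (1 - t) ⟨by linarith [ht.2], by linarith [ht.1]⟩
    rwa [sub_sub_cancel, max_comm] at this

lemma Z_swap {x y : ℝ} (hx : x ∈ Ioo (0 : ℝ) 1) (hy : y ∈ Ioo (0 : ℝ) 1) :
    Z y x = 1 - Z x y := by
  have h1 := Real.log_neg hx.1 hx.2
  have h2 := Real.log_neg hy.1 hy.2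
  have : Real.log x + Real.log y ≠ 0 := by linarith
  rw [Z_eq hx.1 hy.1, Z_eq hy.1 hx.1, add_comm (Real.log y)]
  field_simp; ring

lemma copula_reflect (A : ℝ → ℝ) {x y : ℝ} (hx : x ∈ Ioo (0 : ℝ) 1)
    (hy : y ∈ Ioo (0 : ℝ) 1) : evCopula (fun t => A (1 - t)) y x = evCopula A x y := by
  have := Z_swap hx hy
  simp only [Z] at this
  rw [evCopula, evCopula, this, sub_sub_cancel, mul_comm]

lemma half_le (hA : IsPickands A) {t : ℝ} (ht : t ∈ Icc (0 : ℝ) 1) : 1 / 2 ≤ A t := by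
  have := (hA.2 t ht).1
  linarith [le_max_left (1 - t) t, le_max_right (1 - t) t]

lemma aemeasurable (hA : IsPickands A) : AEMeasurable A (volume.restrict (Ioo 0 1)) :=
  (hA.continuousOn.mono Ioo_subset_Icc_self).aemeasurable measurableSet_Ioo

/-- `A` is arbitrary outside `[0, 1]`, hence need not be measurable on the line; this version is
what joint measurability arguments use. -/
lemma exists_measurable_eq (hA : IsPickands A) :
    ∃ B : ℝ → ℝ, Measurable B ∧ ∀ t ∈ Icc (0 : ℝ) 1, B t = A t :=
  ⟨(Icc (0 : ℝ) 1).piecewise A 0,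
    hA.continuousOn.measurable_piecewise continuousOn_const measurableSet_Icc,
    fun _ ht => Set.piecewise_eq_of_mem _ _ _ ht⟩

lemma measurable_D (A : ℝ → ℝ) : Measurable (D A) := measurable_derivWithin_Ioi A

lemma F_eq {x y : ℝ} (hy : y ∈ Ioo (0 : ℝ) 1) :
    F A x y = x⁻¹ * (evCopula A x y * K A (Z x y)) := by
  simp only [F, not_le.2 hy.1, not_le.2 hy.2, if_false]

lemma exists_measurable_F (hA : IsPickands A) :
    ∃ g : ℝ × ℝ → ℝ, Measurable g ∧
      ∀ x ∈ Ioo (0 : ℝ) 1, ∀ y ∈ Ioo (0 : ℝ) 1, g (x, y) = F A x y := by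
  obtain ⟨B, hB, hBA⟩ := hA.exists_measurable_eq
  have hZ : Measurable fun p : ℝ × ℝ => Z p.1 p.2 := by unfold Z; fun_prop
  have hD : Measurable fun p : ℝ × ℝ => D A (Z p.1 p.2) := (measurable_D A).comp hZ
  refine ⟨fun p => p.1⁻¹ * ((p.1 * p.2) ^ B (Z p.1 p.2) *
    (B (Z p.1 p.2) + (1 - Z p.1 p.2) * D A (Z p.1 p.2))), ?_, fun x hx y hy => ?_⟩
  · have := hB.comp hZ
    exact measurable_fst.inv.mul (((measurable_fst.mul measurable_snd).pow this).mul
      (this.add ((measurable_const.sub hZ).mul hD)))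
  · have := hBA _ (Ioo_subset_Icc_self (Z_mem hx hy))
    simp only [this, F_eq hy, K]
    rfl

end IsPickands

/-! ### Integration by parts against the copula measure -/

/-- Uniform marginals do not charge the boundary of the square, so the formulas valid on the open
square suffice. -/
lemma ae_mem_Ioo_of_map_eq {μ : Measure (ℝ × ℝ)} {f : ℝ × ℝ → ℝ} (hf : Measurable f)
    (h : μ.map f = volume.restrict (Icc 0 1)) : ∀ᵐ p ∂μ, f p ∈ Ioo (0 : ℝ) 1 := by
  have : ∀ᵐ x ∂(μ.map f), x ∈ Ioo (0 : ℝ) 1 := by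
    rw [h, ← restrict_Ioo_eq_restrict_Icc]
    exact ae_restrict_mem measurableSet_Ioo
  exact ae_of_ae_map hf.aemeasurable this

namespace IsCopulaMeasure

variable {A : ℝ → ℝ} {μ : Measure (ℝ × ℝ)}

/-- `F A · y` is the density of the first marginal of `μ` restricted to `ℝ × (-∞, y]`. -/
lemma map_fst_restrict (hA : IsPickands A) (hμ : IsCopulaMeasure (evCopula A) μ) {y : ℝ}
    (hy : y ∈ Ioo (0 : ℝ) 1) :
    (μ.restrict (Prod.snd ⁻¹' Iic y)).map Prod.fst =
      (volume.restrict (Ioo 0 1)).withDensity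
        fun x => ENNReal.ofReal (IsPickands.F A (IsPickands.clip x) y) := by
  have := hμ.isProbabilityMeasure
  have hfst := ae_mem_Ioo_of_map_eq measurable_fst hμ.map_fst
  have hsnd := ae_mem_Ioo_of_map_eq measurable_snd hμ.map_snd
  have hyI : y ∈ Icc (0 : ℝ) 1 := Ioo_subset_Icc_self hy
  refine Measure.ext_of_Iic _ _ fun a => ?_
  rw [Measure.map_apply measurable_fst measurableSet_Iic,
    Measure.restrict_apply (measurable_fst measurableSet_Iic),
    withDensity_apply _ measurableSet_Iic, Measure.restrict_restrict measurableSet_Iic]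
  -- Clamping `a` to `[0, 1]` changes neither side up to null sets and turns the half-lines into a
  -- rectangle whose measure `apply_Icc` gives.
  set b := max 0 (min a 1) with hb
  have hbI : b ∈ Icc (0 : ℝ) 1 := ⟨le_max_left _ _, max_le zero_le_one (min_le_right _ _)⟩
  have hset : (Prod.fst ⁻¹' Iic a ∩ Prod.snd ⁻¹' Iic y : Set (ℝ × ℝ)) =ᵐ[μ] Icc 0 b ×ˢ Icc 0 y := by
    filter_upwards [hfst, hsnd] with p h1 h2
    apply propext
    change (p.1 ≤ a ∧ p.2 ≤ y) ↔ ((0 ≤ p.1 ∧ p.1 ≤ b) ∧ (0 ≤ p.2 ∧ p.2 ≤ y))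
    have : p.1 ≤ b ↔ p.1 ≤ a := by
      rw [hb, le_max_iff, le_min_iff]
      exact ⟨fun h => h.elim (fun h => absurd h (not_le.2 h1.1)) And.left,
        fun h => Or.inr ⟨h, h1.2.le⟩⟩
    rw [this]
    exact ⟨fun h => ⟨⟨h1.1.le, h.1⟩, h2.1.le, h.2⟩, fun h => ⟨h.1.2, h.2.2⟩⟩
  have hset' : (Iic a ∩ Ioo 0 1 : Set ℝ) =ᵐ[volume] Ioo 0 b := by
    have : Iic a ∩ Ioo 0 1 ⊆ Icc 0 b ∧ Ioo 0 b ⊆ Iic a ∩ Ioo 0 1 := by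
      constructor
      · rintro x ⟨hx, hx'⟩
        exact ⟨hx'.1.le, le_max_of_le_right (le_min hx hx'.2.le)⟩
      · rintro x ⟨hx, hx'⟩
        rcases lt_max_iff.1 hx' with h | h
        · exact absurd hx (not_lt.2 h.le)
        · exact ⟨(lt_min_iff.1 h).1.le, hx, (lt_min_iff.1 h).2⟩
    exact (this.1.eventuallyLE.trans Ioo_ae_eq_Icc.symm.le).antisymm this.2.eventuallyLE
  rw [measure_congr hset, hμ.apply_Icc b hbI y hyI, Measure.restrict_congr_set hset',
    hA.integral_F hbI hyI]

/-- Integration by parts for the integral of the copula against its own measure. -/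
lemma lintegral_copula_add (hA : IsPickands A) (hμ : IsCopulaMeasure (evCopula A) μ) :
    ∫⁻ p, ENNReal.ofReal (evCopula A p.1 p.2) ∂μ +
      ∫⁻ p in Ioo (0 : ℝ) 1 ×ˢ Ioo (0 : ℝ) 1, ENNReal.ofReal
        (IsPickands.F A p.1 p.2 * IsPickands.F (fun t => A (1 - t)) p.2 p.1) =
      ENNReal.ofReal (1 / 2) := by
  have := hμ.isProbabilityMeasure
  have hfst := ae_mem_Ioo_of_map_eq measurable_fst hμ.map_fst
  have hsnd := ae_mem_Ioo_of_map_eq measurable_snd hμ.map_snd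
  have hA' := hA.reflect
  obtain ⟨g, hg, hgF⟩ := hA.exists_measurable_F
  obtain ⟨g', hg', hgF'⟩ := hA'.exists_measurable_F
  -- By reflection `g' (v, x)` is the one-sided `∂C/∂y` at `(x, v)`, so its integral over `v`
  -- recovers the copula.
  have hin : ∀ x ∈ Ioo (0 : ℝ) 1, ∀ y ∈ Icc (0 : ℝ) 1,
      ∫⁻ v in Ioo 0 y, ENNReal.ofReal (g' (v, x)) =
        ENNReal.ofReal (evCopula (fun t => A (1 - t)) y x) := by
    intro x hx y hy
    rw [← hA'.integral_F hy (Ioo_subset_Icc_self hx)]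
    refine setLIntegral_congr_fun measurableSet_Ioo fun v hv => ?_
    have hv' : v ∈ Ioo (0 : ℝ) 1 := ⟨hv.1, hv.2.trans_le hy.2⟩
    simp only [hgF' v hv' x hx, IsPickands.clip, if_pos hv']
  -- This is `C (x, y) + ∫_y^1 ∂₂C (x, v) dv = C (x, 1) = x`, to be integrated against `μ`.
  have hsplit : ∀ᵐ p ∂μ, ENNReal.ofReal (evCopula A p.1 p.2) +
      ∫⁻ v in Ioo (0 : ℝ) 1, (if p.2 ≤ v then ENNReal.ofReal (g' (v, p.1)) else 0) =
      ENNReal.ofReal p.1 := by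
    filter_upwards [hfst, hsnd] with p h1 h2
    have e1 := hin p.1 h1 p.2 (Ioo_subset_Icc_self h2)
    rw [IsPickands.copula_reflect A h1 h2] at e1
    have e2 := hin p.1 h1 1 (by simp)
    rw [hA'.copula_one_left] at e2
    have e3 : ∫⁻ v in Ioo (0 : ℝ) 1, (if p.2 ≤ v then ENNReal.ofReal (g' (v, p.1)) else 0) =
        ∫⁻ v in Ico p.2 1, ENNReal.ofReal (g' (v, p.1)) := by
      have : (fun v => if p.2 ≤ v then ENNReal.ofReal (g' (v, p.1)) else 0) =
          (Ici p.2).indicator fun v => ENNReal.ofReal (g' (v, p.1)) := by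
        funext v; simp [indicator]
      rw [this, lintegral_indicator measurableSet_Ici, Measure.restrict_restrict measurableSet_Ici]
      congr 2
      ext v
      simp only [mem_inter_iff, mem_Ici, mem_Ioo, mem_Ico]
      exact ⟨fun h => ⟨h.1, h.2.2⟩, fun h => ⟨h.1, h2.1.trans_le h.1, h.2⟩⟩
    rw [e3, ← e1, ← e2, ← Ioo_union_Ico_eq_Ioo h2.1 h2.2.le,
      lintegral_union measurableSet_Ico]
    exact Set.disjoint_left.2 fun v hv hv' => not_lt.2 hv'.1 hv.2
  have hmeas : Measurable fun q : (ℝ × ℝ) × ℝ =>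
      if q.1.2 ≤ q.2 then ENNReal.ofReal (g' (q.2, q.1.1)) else 0 := by
    refine Measurable.ite (measurableSet_le (by fun_prop) (by fun_prop)) ?_ measurable_const
    exact (hg'.comp (measurable_snd.prodMk (measurable_fst.comp measurable_fst))).ennreal_ofReal
  -- For fixed `v`, the measure `μ` restricted to `p.2 ≤ v` projects to the density `F A · v`, that
  -- is `∂₁C`; Tonelli then produces `∫ ∂₁C ∂₂C`.
  have hswap : ∫⁻ p, (∫⁻ v in Ioo (0 : ℝ) 1,
      if p.2 ≤ v then ENNReal.ofReal (g' (v, p.1)) else 0) ∂μ =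
      ∫⁻ p in Ioo (0 : ℝ) 1 ×ˢ Ioo (0 : ℝ) 1, ENNReal.ofReal
        (IsPickands.F A p.1 p.2 * IsPickands.F (fun t => A (1 - t)) p.2 p.1) := by
    rw [lintegral_lintegral_swap (f := fun (p : ℝ × ℝ) v =>
      if p.2 ≤ v then ENNReal.ofReal (g' (v, p.1)) else 0) hmeas.aemeasurable]
    have e : ∀ p ∈ Ioo (0 : ℝ) 1 ×ˢ Ioo (0 : ℝ) 1, ENNReal.ofReal
        (IsPickands.F A p.1 p.2 * IsPickands.F (fun t => A (1 - t)) p.2 p.1) =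
        ENNReal.ofReal (g p * g' (p.2, p.1)) := by
      rintro ⟨x, y⟩ ⟨hx, hy⟩
      rw [hgF x hx y hy, hgF' y hy x hx]
    have hgg : Measurable fun p : ℝ × ℝ => ENNReal.ofReal (g p * g' (p.2, p.1)) :=
      (hg.mul (hg'.comp measurable_swap)).ennreal_ofReal
    rw [setLIntegral_congr_fun (measurableSet_Ioo.prod measurableSet_Ioo) e,
      Measure.volume_eq_prod, ← Measure.prod_restrict, lintegral_prod_symm _ hgg.aemeasurable]
    refine setLIntegral_congr_fun measurableSet_Ioo fun v hv => ?_
    have hg'v : Measurable fun x => ENNReal.ofReal (g' (v, x)) :=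
      (hg'.comp measurable_prodMk_left).ennreal_ofReal
    have e1 : (fun p : ℝ × ℝ => if p.2 ≤ v then ENNReal.ofReal (g' (v, p.1)) else 0) =
        (Prod.snd ⁻¹' Iic v).indicator fun p => ENNReal.ofReal (g' (v, p.1)) := by
      funext p; simp [indicator]
    rw [e1, lintegral_indicator (measurable_snd measurableSet_Iic),
      ← lintegral_map (f := fun x => ENNReal.ofReal (g' (v, x))) hg'v measurable_fst,
      hμ.map_fst_restrict hA hv,
      lintegral_withDensity_eq_lintegral_mul _ (hA.F_measurable v).ennreal_ofReal hg'v]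
    refine setLIntegral_congr_fun measurableSet_Ioo fun x hx => ?_
    simp only [Pi.mul_apply, IsPickands.clip, if_pos hx, hgF x hx v hv]
    rw [ENNReal.ofReal_mul (hA.F_nonneg hx v)]
  have hid : IntegrableOn (fun x : ℝ => x) (Icc 0 1) := continuous_id.integrableOn_Icc
  rw [← hswap, ← lintegral_add_right _ hmeas.lintegral_prod_right', lintegral_congr_ae hsplit,
    ← lintegral_map (f := fun x => ENNReal.ofReal x) ENNReal.measurable_ofReal measurable_fst,
    hμ.map_fst, ← ofReal_integral_eq_lintegral_ofReal hid
      ((ae_restrict_mem measurableSet_Icc).mono fun x hx => hx.1)]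
  congr 1
  rw [integral_Icc_eq_integral_Ioc, ← intervalIntegral.integral_of_le zero_le_one]
  simp

end IsCopulaMeasure


/-! ### Integral formulas for rho and tau -/

namespace IsPickands

variable {A : ℝ → ℝ}

lemma exists_measurable_copula (hA : IsPickands A) :
    ∃ g : ℝ × ℝ → ℝ, Measurable g ∧
      ∀ p ∈ Ioo (0 : ℝ) 1 ×ˢ Ioo (0 : ℝ) 1, g p = evCopula A p.1 p.2 := by
  obtain ⟨B, hB, hBA⟩ := hA.exists_measurable_eq
  have hZ : Measurable fun p : ℝ × ℝ => Z p.1 p.2 := by unfold Z; fun_prop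
  refine ⟨fun p => (p.1 * p.2) ^ B (Z p.1 p.2),
    (measurable_fst.mul measurable_snd).pow (hB.comp hZ), fun p hp => ?_⟩
  simp only [hBA _ (Ioo_subset_Icc_self (Z_mem hp.1 hp.2))]
  rfl

/-- Spearman's rho of an extreme-value copula. -/
lemma spearmanRho_eq (hA : IsPickands A) :
    spearmanRho (evCopula A) = 12 * (∫ t in Ioo (0 : ℝ) 1, 1 / (1 + A t) ^ 2) - 3 := by
  have hset : volume.restrict (Icc (0 : ℝ) 1 ×ˢ Icc (0 : ℝ) 1) =
      volume.restrict (Ioo (0 : ℝ) 1 ×ˢ Ioo (0 : ℝ) 1) := by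
    rw [Measure.volume_eq_prod, ← Measure.prod_restrict, ← Measure.prod_restrict,
      restrict_Ioo_eq_restrict_Icc]
  have hmem := ae_restrict_mem (μ := (volume : Measure (ℝ × ℝ)))
    ((measurableSet_Ioo (a := (0 : ℝ)) (b := 1)).prod (measurableSet_Ioo (a := (0 : ℝ)) (b := 1)))
  obtain ⟨g, hg, hgA⟩ := hA.exists_measurable_copula
  have hm : AEMeasurable (fun p : ℝ × ℝ => evCopula A p.1 p.2)
      (volume.restrict (Ioo (0 : ℝ) 1 ×ˢ Ioo (0 : ℝ) 1)) :=
    ⟨g, hg, hmem.mono fun p hp => (hgA p hp).symm⟩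
  have hc := hA.aemeasurable
  -- The copula is `(x y) ^ A`, so the exponent `c - 1` forces `c = 1 + A`.
  have key := lintegral_unitSquare_rpow (c := fun t => 1 + A t) (h := fun _ => 1)
    (hc.const_add 1) aemeasurable_const
    (fun z hz => by linarith [hA.half_le (Ioo_subset_Icc_self hz)])
  rw [spearmanRho, hset, integral_eq_lintegral_of_nonneg_ae
      (hmem.mono fun p hp => copula_nonneg hp.1.1.le hp.2.1.le) hm.aestronglyMeasurable,
    integral_eq_lintegral_of_nonneg_ae (Eventually.of_forall fun t => by positivity)
      ((hc.const_add 1).pow_const 2 |>.const_div 1).aestronglyMeasurable]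
  simp only [mul_one, add_sub_cancel_left] at key
  rw [← key]
  rfl

/-- The right derivative is at least `-1`, so `A t + t` is monotone and Lebesgue's theorem on
monotone functions applies. -/
lemma ae_differentiableAt (hA : IsPickands A) :
    ∀ᵐ t ∂volume.restrict (Ioo (0 : ℝ) 1), DifferentiableAt ℝ A t := by
  have hm : MonotoneOn (fun t => A t + t) (Ioo 0 1) := by
    intro z hz w hw h
    rcases eq_or_lt_of_le h with rfl | h
    · exact le_rfl
    have h1 := hA.D_le_slope hz hw.2.le h
    have h2 := hA.neg_one_le_D hz
    beta_reduce
    nlinarith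
  filter_upwards [hm.ae_differentiableWithinAt measurableSet_Ioo,
    ae_restrict_mem measurableSet_Ioo] with t ht ht'
  have := (ht.differentiableAt (Ioo_mem_nhds ht'.1 ht'.2)).fun_sub differentiableAt_fun_id
  simpa using this

lemma D_of_hasDerivAt {d t : ℝ} (h : HasDerivAt A d t) : D A t = d :=
  h.hasDerivWithinAt.derivWithin (uniqueDiffWithinAt_Ioi t)

/-- Reflection exchanges left and right derivatives, so a two-sided derivative is required; hence
the identity is available only almost everywhere. -/
lemma K_reflect {t : ℝ} (h : DifferentiableAt ℝ A t) :
    K (fun s => A (1 - s)) (1 - t) = A t - t * D A t := by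
  have h' := h.hasDerivAt
  have h2 : HasDerivAt (fun s => A (1 - s)) (-deriv A t) (1 - t) := by
    have e : t = 1 - (1 - t) := by ring
    rw [e] at h'
    have := h'.comp_const_sub 1 (1 - t)
    rwa [← e] at this
  rw [K, D_of_hasDerivAt h2, D_of_hasDerivAt h']
  simp only [sub_sub_cancel]
  ring

/-- Kendall's tau of an extreme-value copula. -/
lemma kendallTau_eq (hA : IsPickands A) :
    kendallTau (evCopula A) =
      1 - ∫ t in Ioo (0 : ℝ) 1, K A t * (A t - t * D A t) / A t ^ 2 := by
  have hμ := hA.isCopulaMeasure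
  set μ := copulaMeasure (evCopula A) with hμdef
  have hA' := hA.reflect
  have hfst := ae_mem_Ioo_of_map_eq measurable_fst hμ.map_fst
  have hsnd := ae_mem_Ioo_of_map_eq measurable_snd hμ.map_snd
  obtain ⟨g, hg, hgA⟩ := hA.exists_measurable_copula
  have hm : AEMeasurable (fun p : ℝ × ℝ => evCopula A p.1 p.2) μ := by
    refine ⟨g, hg, ?_⟩
    filter_upwards [hfst, hsnd] with p h1 h2 using (hgA p ⟨h1, h2⟩).symm
  have hint : ∫ p, evCopula A p.1 p.2 ∂μ = (∫⁻ p, ENNReal.ofReal (evCopula A p.1 p.2) ∂μ).toReal := by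
    refine integral_eq_lintegral_of_nonneg_ae ?_ hm.aestronglyMeasurable
    filter_upwards [hfst, hsnd] with p h1 h2 using copula_nonneg h1.1.le h2.1.le
  have hAm := hA.aemeasurable
  have hKm : AEMeasurable (K A) (volume.restrict (Ioo 0 1)) :=
    hAm.add (((measurable_const.sub measurable_id).mul (measurable_D A)).aemeasurable)
  have hLm : AEMeasurable (fun t => A t - t * D A t) (volume.restrict (Ioo 0 1)) :=
    hAm.sub ((measurable_id.mul (measurable_D A)).aemeasurable)
  have hL : (fun t => A t - t * D A t) =ᵐ[volume.restrict (Ioo 0 1)]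
      fun t => K (fun s => A (1 - s)) (1 - t) :=
    hA.ae_differentiableAt.mono fun t ht => (K_reflect ht).symm
  have hnn : ∀ᵐ t ∂volume.restrict (Ioo (0 : ℝ) 1), 0 ≤ K A t * (A t - t * D A t) / A t ^ 2 := by
    filter_upwards [hL, ae_restrict_mem measurableSet_Ioo] with t ht ht'
    rw [ht]
    have h1 := hA.K_nonneg ht'
    have h2 := hA'.K_nonneg (z := 1 - t) ⟨by linarith [ht'.2], by linarith [ht'.1]⟩
    positivity
  -- The product of the partial derivatives is `C ^ 2 / (x y)` times a function of `Z`, so `c = 2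
  -- A`; the factor `1 / 4` comes from `1 / c ^ 2`.
  have hsq : ∫⁻ p in Ioo (0 : ℝ) 1 ×ˢ Ioo (0 : ℝ) 1, ENNReal.ofReal
        (F A p.1 p.2 * F (fun t => A (1 - t)) p.2 p.1) =
      ENNReal.ofReal (1 / 4) *
        ∫⁻ t in Ioo (0 : ℝ) 1, ENNReal.ofReal (K A t * (A t - t * D A t) / A t ^ 2) := by
    have e : ∀ p ∈ Ioo (0 : ℝ) 1 ×ˢ Ioo (0 : ℝ) 1, ENNReal.ofReal
        (F A p.1 p.2 * F (fun t => A (1 - t)) p.2 p.1) =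
        ENNReal.ofReal ((p.1 * p.2) ^ (2 * A (Z p.1 p.2) - 1) *
          (K A (Z p.1 p.2) * K (fun s => A (1 - s)) (1 - Z p.1 p.2))) := by
      rintro ⟨x, y⟩ ⟨hx, hy⟩
      have hxy : 0 < x * y := mul_pos hx.1 hy.1
      have hC : evCopula A x y = (x * y) ^ A (Z x y) := rfl
      congr 1
      simp only [F_eq hy, F_eq (A := fun t => A (1 - t)) hx, Z_swap hx hy, copula_reflect A hx hy,
        hC, Real.rpow_sub hxy, Real.rpow_one, two_mul, Real.rpow_add hxy]
      have := hx.1.ne'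
      have := hy.1.ne'
      field_simp
    rw [setLIntegral_congr_fun (measurableSet_Ioo.prod measurableSet_Ioo) e,
      lintegral_unitSquare_rpow (c := fun t => 2 * A t)
        (h := fun t => K A t * K (fun s => A (1 - s)) (1 - t)) (hAm.const_mul 2)
        (hKm.mul (hLm.congr hL))
        (fun z hz => by linarith [hA.half_le (Ioo_subset_Icc_self hz)]),
      ← lintegral_const_mul' _ _ ENNReal.ofReal_ne_top]
    refine lintegral_congr_ae ?_
    filter_upwards [hL] with t ht
    rw [← ht, ← ENNReal.ofReal_mul (by norm_num)]
    congr 1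
    ring
  have hI : ∫ t in Ioo (0 : ℝ) 1, K A t * (A t - t * D A t) / A t ^ 2 =
      (∫⁻ t in Ioo (0 : ℝ) 1, ENNReal.ofReal (K A t * (A t - t * D A t) / A t ^ 2)).toReal :=
    integral_eq_lintegral_of_nonneg_ae hnn
      ((hKm.mul hLm).div (hAm.pow_const 2)).aestronglyMeasurable
  have hmain := hμ.lintegral_copula_add hA
  -- The sum is `1 / 2`, so both terms are finite and the identity passes to real numbers.
  have hfin := hmain.trans_ne ENNReal.ofReal_ne_top
  rw [ENNReal.add_ne_top] at hfin
  have hreal := congrArg ENNReal.toReal hmain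
  rw [ENNReal.toReal_add hfin.1 hfin.2, hsq, ENNReal.toReal_mul, ← hI, ← hint,
    ENNReal.toReal_ofReal (by norm_num), ENNReal.toReal_ofReal (by norm_num)] at hreal
  rw [kendallTau, ← hμdef]
  linarith

end IsPickands


/-! ### Upper bound for Kendall's tau -/

/-- A nonnegative function vanishing at both ends has a derivative that correlates negatively with
every monotone function. -/
lemma integral_mul_deriv_nonpos {D w w' : ℝ → ℝ} (hD : MonotoneOn D (Ioo 0 1))
    (hDb : ∀ t ∈ Ioo (0 : ℝ) 1, D t ∈ Icc (-1 : ℝ) 1) (hDm : Measurable D)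
    (hw : ContinuousOn w (Icc 0 1)) (h0 : w 0 = 0) (h1 : w 1 = 0)
    (hnn : ∀ t ∈ Icc (0 : ℝ) 1, 0 ≤ w t)
    (hd : ∀ t ∈ Ioo (0 : ℝ) 1, HasDerivWithinAt w (w' t) (Ioi t) t)
    (hint : IntegrableOn w' (Ioo 0 1)) : ∫ t in Ioo (0 : ℝ) 1, D t * w' t ≤ 0 := by
  have ftc : ∀ a ∈ Icc (0 : ℝ) 1, ∫ t in Ioo a 1, w' t = - w a := by
    intro a ha
    rw [← integral_Ioc_eq_integral_Ioo, ← intervalIntegral.integral_of_le ha.2,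
      intervalIntegral.integral_eq_sub_of_hasDeriv_right_of_le ha.2
        (hw.mono (Icc_subset_Icc_left ha.1)) (fun t ht => hd t ⟨ha.1.trans_lt ht.1, ht.2⟩) ?_,
      h1, zero_sub]
    rw [intervalIntegrable_iff_integrableOn_Ioo_of_le ha.2]
    exact hint.mono_set (Ioo_subset_Ioo_left ha.1)
  -- A superlevel set of a monotone function on `(0, 1)` is, up to an endpoint, empty or an interval
  -- `(a, 1)`, over which `w'` integrates to `-w a ≤ 0`.
  have level : ∀ c : ℝ, ∫ t in Ioo (0 : ℝ) 1, (if c < D t then w' t else 0) ≤ 0 := by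
    intro c
    have e : (fun t => if c < D t then w' t else 0) = {t | c < D t}.indicator w' := by
      funext t; simp [indicator]
    have hms : MeasurableSet {t | c < D t} := measurableSet_lt measurable_const hDm
    rw [e, integral_indicator hms, Measure.restrict_restrict hms]
    set S := {t | c < D t} ∩ Ioo 0 1 with hS
    rcases S.eq_empty_or_nonempty with h | h
    · simp [h]
    have hbdd : BddBelow S := ⟨0, fun t ht => ht.2.1.le⟩
    have ha : sInf S ∈ Icc (0 : ℝ) 1 := by
      obtain ⟨t, ht⟩ := h
      exact ⟨le_csInf ⟨t, ht⟩ fun t ht => ht.2.1.le, (csInf_le hbdd ht).trans ht.2.2.le⟩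
    have hsub1 : S ⊆ Icc (sInf S) 1 := fun t ht => ⟨csInf_le hbdd ht, ht.2.2.le⟩
    have hsub2 : Ioo (sInf S) 1 ⊆ S := by
      intro t ht
      obtain ⟨r, hr, hrt⟩ := exists_lt_of_csInf_lt h ht.1
      have ht' : t ∈ Ioo (0 : ℝ) 1 := ⟨hr.2.1.trans hrt, ht.2⟩
      exact ⟨lt_of_lt_of_le hr.1 (hD hr.2 ht' hrt.le), ht'⟩
    have hae : S =ᵐ[volume] Ioo (sInf S) 1 :=
      (hsub1.eventuallyLE.trans Ioo_ae_eq_Icc.symm.le).antisymm hsub2.eventuallyLE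
    rw [Measure.restrict_congr_set hae, ftc _ ha]
    linarith [hnn _ ha]
  -- Layer-cake formula: as `D` has values in `[-1, 1]`, `D + 1` is the integral over `c` of the
  -- indicator of `c < D`. The added 1 is harmless because `w'` has total integral 0.
  have hlayer : ∀ t ∈ Ioo (0 : ℝ) 1,
      ∫ c in Ioc (-1 : ℝ) 1, (if c < D t then w' t else 0) = (D t + 1) * w' t := by
    intro t ht
    have e : (fun c => if c < D t then w' t else 0) = (Iio (D t)).indicator fun _ => w' t := by
      funext t; simp [indicator]
    have e2 : Iio (D t) ∩ Ioc (-1) 1 = Ioo (-1) (D t) := by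
      ext c
      simp only [mem_inter_iff, mem_Iio, mem_Ioc, mem_Ioo]
      exact ⟨fun h => ⟨h.2.1, h.1⟩, fun h => ⟨h.2, h.1, h.2.le.trans (hDb t ht).2⟩⟩
    rw [e, integral_indicator measurableSet_Iio, Measure.restrict_restrict measurableSet_Iio, e2,
      setIntegral_const, measureReal_def, Real.volume_Ioo,
      ENNReal.toReal_ofReal (by linarith [(hDb t ht).1]), smul_eq_mul]
    ring
  have hprod : Integrable (Function.uncurry fun t c => if c < D t then w' t else 0)
      ((volume.restrict (Ioo (0 : ℝ) 1)).prod (volume.restrict (Ioc (-1 : ℝ) 1))) := by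
    have hI := Integrable.comp_fst (ν := volume.restrict (Ioc (-1 : ℝ) 1)) hint
    have hms : MeasurableSet {q : ℝ × ℝ | q.2 < D q.1} :=
      measurableSet_lt measurable_snd (hDm.comp measurable_fst)
    refine (hI.indicator hms).congr (Eventually.of_forall fun q => ?_)
    simp [indicator, Function.uncurry]
  have hDint : IntegrableOn (fun t => D t * w' t) (Ioo 0 1) := by
    refine hint.bdd_mul (c := 1) hDm.aestronglyMeasurable ?_
    filter_upwards [ae_restrict_mem measurableSet_Ioo] with t ht
    exact abs_le.2 (hDb t ht)
  have hsum : ∫ t in Ioo (0 : ℝ) 1, (D t + 1) * w' t ≤ 0 := by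
    rw [← setIntegral_congr_fun measurableSet_Ioo hlayer, integral_integral_swap hprod]
    exact integral_nonpos fun c => level c
  have hw0 := ftc 0 (by simp)
  simp only [add_mul, one_mul] at hsum
  rw [integral_add hDint hint, hw0, h0] at hsum
  linarith

namespace IsPickands

variable {A : ℝ → ℝ}

lemma D_mem (hA : IsPickands A) {t : ℝ} (ht : t ∈ Ioo (0 : ℝ) 1) : D A t ∈ Icc (-1 : ℝ) 1 := by
  refine ⟨hA.neg_one_le_D ht, ?_⟩
  have h1 := hA.D_le_slope ht le_rfl ht.2
  have h2 := (le_max_right _ _).trans (hA.2 t ⟨ht.1.le, ht.2.le⟩).1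
  rw [hA.at_one] at h1
  have : D A t * (1 - t) ≤ 1 * (1 - t) := by linarith
  exact le_of_mul_le_mul_right this (sub_pos.2 ht.2)

lemma ae_norm_D_le (hA : IsPickands A) :
    ∀ᵐ t ∂volume.restrict (Ioo (0 : ℝ) 1), ‖D A t‖ ≤ 1 :=
  (ae_restrict_mem measurableSet_Ioo).mono fun _ ht => abs_le.2 (hA.D_mem ht)

lemma integrableOn_mul_D (hA : IsPickands A) {φ : ℝ → ℝ} (hφ : ContinuousOn φ (Icc 0 1)) :
    IntegrableOn (fun t => φ t * D A t) (Ioo 0 1) :=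
  (hφ.integrableOn_Icc.mono_set Ioo_subset_Icc_self).mul_bdd
    (measurable_D A).aestronglyMeasurable hA.ae_norm_D_le

lemma integrableOn (hA : IsPickands A) : IntegrableOn A (Ioo 0 1) :=
  hA.continuousOn.integrableOn_Icc.mono_set Ioo_subset_Icc_self

/-- Integration by parts with `(1 - 2 t) A t`, whose boundary terms contribute `-2` because `A 0 = A
1 = 1`. -/
lemma integral_mul_D (hA : IsPickands A) :
    ∫ t in Ioo (0 : ℝ) 1, (1 - 2 * t) * D A t = -(2 * ∫ t in Ioo (0 : ℝ) 1, (1 - A t)) := by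
  have hi := hA.integrableOn_mul_D (φ := fun t => 1 - 2 * t) (by fun_prop)
  have hi2 : IntegrableOn (fun t => -2 * A t) (Ioo 0 1) := hA.integrableOn.const_mul (-2)
  have h : ∫ t in (0 : ℝ)..1, (-2 * A t + (1 - 2 * t) * D A t) =
      (1 - 2 * 1) * A 1 - (1 - 2 * 0) * A 0 := by
    refine intervalIntegral.integral_eq_sub_of_hasDeriv_right_of_le
      (f := fun t => (1 - 2 * t) * A t) zero_le_one
      (ContinuousOn.mul (by fun_prop) hA.continuousOn) (fun t ht => ?_) ?_
    · have := ((hasDerivAt_id' t).const_mul 2).const_sub 1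
      exact (this.hasDerivWithinAt.mul (hA.hasDeriv ht)).congr_deriv (by ring)
    · rw [intervalIntegrable_iff_integrableOn_Ioo_of_le zero_le_one]
      exact hi2.add hi
  rw [intervalIntegral.integral_of_le zero_le_one, integral_Ioc_eq_integral_Ioo,
    integral_add hi2 hi, hA.at_one, hA.at_zero, integral_const_mul] at h
  rw [integral_sub (integrable_const 1) hA.integrableOn]
  simp
  linarith

/-- The integrand in the tau formula is `1 + (1 - 2 t) D / A - t (1 - t) D ^ 2 / A ^ 2`. With `w = t
(1 - t) (1 / m - 1 / A)` this equals `1 + (1 - 2 t) D / m - D w'`. The middle term integrates to `-2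
∫ (1 - A) / m`, and `∫ D w' ≤ 0` because `w ≥ 0` vanishes at both ends and `D` is monotone. -/
lemma kendallTau_le (hA : IsPickands A) {m : ℝ} (hm : 0 < m) (hmA : ∀ t ∈ Icc (0 : ℝ) 1, m ≤ A t) :
    kendallTau (evCopula A) ≤ (2 * ∫ t in Ioo (0 : ℝ) 1, (1 - A t)) / m := by
  have hne : ∀ t ∈ Icc (0 : ℝ) 1, A t ≠ 0 := fun t ht => (hm.trans_le (hmA t ht)).ne'
  set w' : ℝ → ℝ := fun t => (1 - 2 * t) * (1 / m - 1 / A t) + t * (1 - t) / A t ^ 2 * D A t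
    with hw'
  have hcont : ContinuousOn (fun t => 1 / m - 1 / A t) (Icc 0 1) :=
    continuousOn_const.sub (continuousOn_const.div hA.continuousOn hne)
  have hw'int : IntegrableOn w' (Ioo 0 1) := by
    refine Integrable.add ?_ (hA.integrableOn_mul_D ?_)
    · have : ContinuousOn (fun t => (1 - 2 * t) * (1 / m - 1 / A t)) (Icc 0 1) :=
        ContinuousOn.mul (by fun_prop) hcont
      exact this.integrableOn_Icc.mono_set Ioo_subset_Icc_self
    · exact ContinuousOn.div (by fun_prop) (hA.continuousOn.pow 2)
        fun t ht => pow_ne_zero 2 (hne t ht)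
  have hneg := integral_mul_deriv_nonpos (w := fun t => t * (1 - t) * (1 / m - 1 / A t)) (w' := w')
    hA.D_mono (fun t ht => hA.D_mem ht) (measurable_D A)
    (ContinuousOn.mul (by fun_prop) hcont) (by simp) (by simp)
    (fun t ht => mul_nonneg (mul_nonneg ht.1 (sub_nonneg.2 ht.2))
      (sub_nonneg.2 (one_div_le_one_div_of_le hm (hmA t ht))))
    (fun t ht => by
      have h1 := (hasDerivAt_id' t).mul ((hasDerivAt_id' t).const_sub 1)
      have hn := hne t (Ioo_subset_Icc_self ht)
      have h2 := ((hasDerivWithinAt_const t (Ioi t) (1 : ℝ)).div (hA.hasDeriv ht) hn).const_sub (1 / m)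
      refine (h1.hasDerivWithinAt.mul h2).congr_deriv ?_
      simp only [hw', Pi.div_apply, Pi.mul_apply]
      ring) hw'int
  have hDw : IntegrableOn (fun t => D A t * w' t) (Ioo 0 1) :=
    hw'int.bdd_mul (measurable_D A).aestronglyMeasurable hA.ae_norm_D_le
  have hi := hA.integrableOn_mul_D (φ := fun t => 1 - 2 * t) (by fun_prop)
  have e : ∀ t ∈ Ioo (0 : ℝ) 1, K A t * (A t - t * D A t) / A t ^ 2 =
      1 + 1 / m * ((1 - 2 * t) * D A t) - D A t * w' t := by
    intro t ht
    have hn := hne t (Ioo_subset_Icc_self ht)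
    simp only [hw', K]
    field_simp
    ring
  have h1i : IntegrableOn (fun t => 1 + 1 / m * ((1 - 2 * t) * D A t)) (Ioo 0 1) :=
    (integrable_const 1).add (hi.const_mul _)
  rw [hA.kendallTau_eq, setIntegral_congr_fun measurableSet_Ioo e, integral_sub h1i hDw,
    integral_add (integrable_const 1) (hi.const_mul _), integral_const_mul, hA.integral_mul_D]
  have : 1 / m * -(2 * ∫ t in Ioo (0 : ℝ) 1, (1 - A t)) =
    -((2 * ∫ t in Ioo (0 : ℝ) 1, (1 - A t)) / m) := by ring
  rw [this]
  simp
  linarith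

end IsPickands


/-! ### Explicit values for tents -/

lemma setIntegral_Ioo_eq_sub {f g G : ℝ → ℝ} {a b : ℝ} (hab : a ≤ b)
    (hfg : ∀ t ∈ Ioo a b, f t = g t) (hG : ∀ t ∈ Icc a b, HasDerivAt G (g t) t)
    (hg : ContinuousOn g (Icc a b)) :
    IntegrableOn f (Ioo a b) ∧ ∫ t in Ioo a b, f t = G b - G a := by
  have hgi : IntegrableOn g (Ioo a b) := hg.integrableOn_Icc.mono_set Ioo_subset_Icc_self
  refine ⟨hgi.congr_fun (fun t ht => (hfg t ht).symm) measurableSet_Ioo, ?_⟩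
  rw [setIntegral_congr_fun measurableSet_Ioo hfg, ← integral_Ioc_eq_integral_Ioo,
    ← intervalIntegral.integral_of_le hab]
  refine intervalIntegral.integral_eq_sub_of_hasDerivAt (fun t ht => hG t ?_) ?_
  · rwa [uIcc_of_le hab] at ht
  · rwa [intervalIntegrable_iff_integrableOn_Ioo_of_le hab]

/-- Integration over `(0, 1)` of a function given by different formulas on both sides of `x`. -/
lemma setIntegral_Ioo_piecewise {f g₁ g₂ G₁ G₂ : ℝ → ℝ} {x : ℝ} (hx : x ∈ Ioo (0 : ℝ) 1)
    (h₁ : ∀ t ∈ Ioo 0 x, f t = g₁ t) (h₂ : ∀ t ∈ Ioo x 1, f t = g₂ t)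
    (hG₁ : ∀ t ∈ Icc 0 x, HasDerivAt G₁ (g₁ t) t) (hG₂ : ∀ t ∈ Icc x 1, HasDerivAt G₂ (g₂ t) t)
    (hg₁ : ContinuousOn g₁ (Icc 0 x)) (hg₂ : ContinuousOn g₂ (Icc x 1)) :
    IntegrableOn f (Ioo 0 1) ∧
      ∫ t in Ioo (0 : ℝ) 1, f t = G₁ x - G₁ 0 + (G₂ 1 - G₂ x) := by
  obtain ⟨i1, e1⟩ := setIntegral_Ioo_eq_sub hx.1.le h₁ hG₁ hg₁
  obtain ⟨i2, e2⟩ := setIntegral_Ioo_eq_sub hx.2.le h₂ hG₂ hg₂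
  have i2' : IntegrableOn f (Ico x 1) := i2.congr_set_ae Ioo_ae_eq_Ico.symm
  have hdisj : Disjoint (Ioo 0 x) (Ico x 1) :=
    Set.disjoint_left.2 fun v hv hv' => not_lt.2 hv'.1 hv.2
  rw [← Ioo_union_Ico_eq_Ioo hx.1 hx.2.le]
  refine ⟨i1.union i2', ?_⟩
  rw [setIntegral_union hdisj measurableSet_Ico i1 i2', integral_Ico_eq_integral_Ioo, e1, e2]

/-- `T` is affine on `[0, x]` and on `[x, 1]`, with `T 0 = T 1 = 1` and `T x = b`. -/
structure IsTent (T : ℝ → ℝ) (x b : ℝ) : Prop where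
  mem : x ∈ Ioo (0 : ℝ) 1
  pos : 0 < b
  le_one : b ≤ 1
  left : ∀ t ∈ Icc 0 x, T t = 1 - (1 - b) / x * t
  right : ∀ t ∈ Icc x 1, T t = 1 - (1 - b) / (1 - x) * (1 - t)

namespace IsTent

variable {T : ℝ → ℝ} {x b : ℝ}

lemma left_pos (h : IsTent T x b) {t : ℝ} (ht : t ∈ Icc 0 x) : 0 < 1 - (1 - b) / x * t := by
  have hx := h.mem.1
  have : (1 - b) / x * t ≤ (1 - b) / x * x :=
    mul_le_mul_of_nonneg_left ht.2 (div_nonneg (sub_nonneg.2 h.le_one) hx.le)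
  rw [div_mul_cancel₀ _ hx.ne'] at this
  linarith [h.pos]

lemma right_pos (h : IsTent T x b) {t : ℝ} (ht : t ∈ Icc x 1) :
    0 < 1 - (1 - b) / (1 - x) * (1 - t) := by
  have hx := sub_pos.2 h.mem.2
  have : (1 - b) / (1 - x) * (1 - t) ≤ (1 - b) / (1 - x) * (1 - x) :=
    mul_le_mul_of_nonneg_left (by linarith [ht.1]) (div_nonneg (sub_nonneg.2 h.le_one) hx.le)
  rw [div_mul_cancel₀ _ hx.ne'] at this
  linarith [h.pos]

lemma integral_one_sub (h : IsTent T x b) : IntegrableOn (fun t => 1 - T t) (Ioo 0 1) ∧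
    ∫ t in Ioo (0 : ℝ) 1, (1 - T t) = (1 - b) / 2 := by
  have hx := h.mem.1.ne'
  have hx' := (sub_pos.2 h.mem.2).ne'
  have := setIntegral_Ioo_piecewise (f := fun t => 1 - T t) (g₁ := fun t => (1 - b) / x * t)
    (g₂ := fun t => (1 - b) / (1 - x) * (1 - t)) (G₁ := fun t => (1 - b) / x * (t ^ 2 / 2))
    (G₂ := fun t => (1 - b) / (1 - x) * (-(1 - t) ^ 2 / 2)) h.mem
    (fun t ht => by simp only [h.left t (Ioo_subset_Icc_self ht)]; ring)
    (fun t ht => by simp only [h.right t (Ioo_subset_Icc_self ht)]; ring)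
    (fun t _ => (((hasDerivAt_pow 2 t).div_const 2).const_mul _).congr_deriv (by ring))
    (fun t _ => ((((((hasDerivAt_id' t).const_sub 1).fun_pow 2).fun_neg).div_const 2).const_mul
      _).congr_deriv (by ring))
    (by fun_prop) (by fun_prop)
  refine ⟨this.1, this.2.trans ?_⟩
  field_simp
  ring

lemma integral_inv_sq (h : IsTent T x b) : IntegrableOn (fun t => 1 / (1 + T t) ^ 2) (Ioo 0 1) ∧
    ∫ t in Ioo (0 : ℝ) 1, 1 / (1 + T t) ^ 2 = 1 / (2 * (1 + b)) := by
  have hx := h.mem.1.ne'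
  have hx' := (sub_pos.2 h.mem.2).ne'
  have hb := h.pos
  have hl : ∀ t ∈ Icc 0 x, 1 + (1 - (1 - b) / x * t) ≠ 0 := fun t ht => by
    linarith [h.left_pos ht]
  have hr : ∀ t ∈ Icc x 1, 1 + (1 - (1 - b) / (1 - x) * (1 - t)) ≠ 0 := fun t ht => by
    linarith [h.right_pos ht]
  have := setIntegral_Ioo_piecewise (f := fun t => 1 / (1 + T t) ^ 2)
    (g₁ := fun t => 1 / (1 + (1 - (1 - b) / x * t)) ^ 2)
    (g₂ := fun t => 1 / (1 + (1 - (1 - b) / (1 - x) * (1 - t))) ^ 2)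
    -- These antiderivatives vanish at 0 and at 1 respectively and, unlike the usual ones, do not
    -- divide by the slope, so the flat case `b = 1` is included.
    (G₁ := fun t => t / (2 * (1 + (1 - (1 - b) / x * t))))
    (G₂ := fun t => -(1 - t) / (2 * (1 + (1 - (1 - b) / (1 - x) * (1 - t))))) h.mem
    (fun t ht => by simp only [h.left t (Ioo_subset_Icc_self ht)])
    (fun t ht => by simp only [h.right t (Ioo_subset_Icc_self ht)])
    (fun t ht => by
      have hne := hl t ht
      have h1 := ((((hasDerivAt_id' t).const_mul ((1 - b) / x)).const_sub 1).const_add 1).const_mul 2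
      refine ((hasDerivAt_id' t).fun_div h1 (mul_ne_zero two_ne_zero hne)).congr_deriv ?_
      generalize (1 - b) / x = α at *
      field_simp
      ring)
    (fun t ht => by
      have hne := hr t ht
      have h0 := (hasDerivAt_id' t).const_sub 1
      have h1 := (((h0.const_mul ((1 - b) / (1 - x))).const_sub 1).const_add 1).const_mul 2
      refine (h0.fun_neg.fun_div h1 (mul_ne_zero two_ne_zero hne)).congr_deriv ?_
      generalize (1 - b) / (1 - x) = α at *
      field_simp
      ring)
    (ContinuousOn.div (by fun_prop) (by fun_prop) fun t ht => pow_ne_zero 2 (hl t ht))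
    (ContinuousOn.div (by fun_prop) (by fun_prop) fun t ht => pow_ne_zero 2 (hr t ht))
  refine ⟨this.1, this.2.trans ?_⟩
  rw [div_mul_cancel₀ _ hx, div_mul_cancel₀ _ hx']
  have : 1 + b ≠ 0 := by linarith
  have e : 1 + (1 - (1 - b)) = 1 + b := by ring
  rw [e]
  field_simp
  ring

/-- On each side of `x` the numerator `K (T - t D)` is constant, being the product of the heights of
the supporting line at 1 and at 0. The two pieces give `(x - (1 - b)) / b` and `((1 - x) - (1 - b))
/ b`. -/
lemma kendallTau_eq (h : IsTent T x b) (hT : IsPickands T) :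
    kendallTau (evCopula T) = (1 - b) / b := by
  have hx := h.mem.1.ne'
  have hx' := (sub_pos.2 h.mem.2).ne'
  have hb := h.pos
  have hl : ∀ t ∈ Icc 0 x, 1 - (1 - b) / x * t ≠ 0 := fun t ht => (h.left_pos ht).ne'
  have hr : ∀ t ∈ Icc x 1, 1 - (1 - b) / (1 - x) * (1 - t) ≠ 0 := fun t ht => (h.right_pos ht).ne'
  have hDl : ∀ t ∈ Ioo 0 x, IsPickands.D T t = -((1 - b) / x) := by
    intro t ht
    refine IsPickands.D_of_hasDerivAt ?_
    have := (((hasDerivAt_id' t).const_mul ((1 - b) / x)).const_sub 1).congr_of_eventuallyEq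
      (Filter.eventuallyEq_of_mem (Ioo_mem_nhds ht.1 ht.2)
        fun s hs => h.left s (Ioo_subset_Icc_self hs))
    exact this.congr_deriv (by ring)
  have hDr : ∀ t ∈ Ioo x 1, IsPickands.D T t = (1 - b) / (1 - x) := by
    intro t ht
    refine IsPickands.D_of_hasDerivAt ?_
    have := ((((hasDerivAt_id' t).const_sub 1).const_mul
      ((1 - b) / (1 - x))).const_sub 1).congr_of_eventuallyEq
      (Filter.eventuallyEq_of_mem (Ioo_mem_nhds ht.1 ht.2)
        fun s hs => h.right s (Ioo_subset_Icc_self hs))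
    exact this.congr_deriv (by ring)
  have := (setIntegral_Ioo_piecewise
    (f := fun t => IsPickands.K T t * (T t - t * IsPickands.D T t) / T t ^ 2)
    (g₁ := fun t => (1 - (1 - b) / x) / (1 - (1 - b) / x * t) ^ 2)
    (g₂ := fun t => (1 - (1 - b) / (1 - x)) / (1 - (1 - b) / (1 - x) * (1 - t)) ^ 2)
    (G₁ := fun t => (1 - (1 - b) / x) * (t / (1 - (1 - b) / x * t)))
    (G₂ := fun t => (1 - (1 - b) / (1 - x)) * (-(1 - t) / (1 - (1 - b) / (1 - x) * (1 - t)))) h.mem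
    (fun t ht => by
      simp only [IsPickands.K, hDl t ht, h.left t (Ioo_subset_Icc_self ht)]
      congr 1; ring)
    (fun t ht => by
      simp only [IsPickands.K, hDr t ht, h.right t (Ioo_subset_Icc_self ht)]
      congr 1; ring)
    (fun t ht => by
      have hne := hl t ht
      have h1 := ((hasDerivAt_id' t).const_mul ((1 - b) / x)).const_sub 1
      refine (((hasDerivAt_id' t).fun_div h1 hne).const_mul _).congr_deriv ?_
      generalize (1 - b) / x = α at *
      field_simp
      ring)
    (fun t ht => by
      have hne := hr t ht
      have h0 := (hasDerivAt_id' t).const_sub 1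
      have h1 := (h0.const_mul ((1 - b) / (1 - x))).const_sub 1
      refine ((h0.fun_neg.fun_div h1 hne).const_mul _).congr_deriv ?_
      generalize (1 - b) / (1 - x) = α at *
      field_simp
      ring)
    (ContinuousOn.div (by fun_prop) (by fun_prop) fun t ht => pow_ne_zero 2 (hl t ht))
    (ContinuousOn.div (by fun_prop) (by fun_prop) fun t ht => pow_ne_zero 2 (hr t ht))).2
  rw [hT.kendallTau_eq, this]
  have e : 1 - (1 - b) = b := by ring
  rw [div_mul_cancel₀ _ hx, div_mul_cancel₀ _ hx', e]
  field_simp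
  ring

lemma spearmanRho_eq (h : IsTent T x b) (hT : IsPickands T) :
    spearmanRho (evCopula T) = 6 / (1 + b) - 3 := by
  have hb := h.pos
  rw [hT.spearmanRho_eq, h.integral_inv_sq.2]
  have : 1 + b ≠ 0 := by linarith
  field_simp
  ring

lemma spearmanRho_eq_kendallTau (h : IsTent T x b) (hT : IsPickands T) :
    spearmanRho (evCopula T) =
      3 * kendallTau (evCopula T) / (2 + kendallTau (evCopula T)) := by
  have hb := h.pos
  rw [h.spearmanRho_eq hT, h.kendallTau_eq hT]
  have h1 : 1 + b ≠ 0 := by linarith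
  have e : 2 + (1 - b) / b = (1 + b) / b := by field_simp; ring
  rw [e]
  field_simp
  ring

end IsTent

/-! ### Comparison with tents and the inequality -/

namespace IsPickands

variable {A : ℝ → ℝ}

lemma isTent_of_isTriangular (hA : IsPickands A) (h : IsTriangular A) : ∃ x b, IsTent A x b := by
  obtain ⟨x, hx, ⟨a, α, hl⟩, ⟨c, β, hr⟩⟩ := h
  have hxI := Ioo_subset_Icc_self hx
  have h0 := hl 0 ⟨le_rfl, hx.1.le⟩
  have hxl := hl x ⟨hx.1.le, le_rfl⟩
  have h1 := hr 1 ⟨hx.2.le, le_rfl⟩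
  have hxr := hr x ⟨le_rfl, hx.2.le⟩
  rw [hA.at_zero] at h0
  rw [hA.at_one] at h1
  have hx0 := hx.1.ne'
  have hx1 := (sub_pos.2 hx.2).ne'
  refine ⟨x, A x, hx, by linarith [hA.half_le hxI], (hA.2 x hxI).2, fun t ht => ?_, fun t ht => ?_⟩
  · rw [hl t ht, hxl]
    field_simp
    linear_combination (t - x) * h0
  · rw [hr t ht, hxr]
    field_simp
    linear_combination (x - t) * h1

/-- By convexity the chords from `(0, 1)` and `(1, 1)` to `(s, A s)` lie above the graph. -/
lemma exists_isTent_le (hA : IsPickands A) {s : ℝ} (hs : s ∈ Ioo (0 : ℝ) 1) :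
    ∃ T, IsTent T s (A s) ∧ ∀ t ∈ Icc (0 : ℝ) 1, A t ≤ T t ∧ T t ≤ 1 := by
  have hs0 := hs.1
  have hs1 := sub_pos.2 hs.2
  have hsI := Ioo_subset_Icc_self hs
  have hb1 := (hA.2 s hsI).2
  have hcv := hA.1.2
  refine ⟨fun t => if t ≤ s then 1 - (1 - A s) / s * t else 1 - (1 - A s) / (1 - s) * (1 - t),
    ⟨hs, by linarith [hA.half_le hsI], hb1, fun t ht => if_pos ht.2, fun t ht => ?_⟩,
    fun t ht => ?_⟩
  · rcases eq_or_lt_of_le ht.1 with rfl | h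
    · simp only [le_refl, if_true]
      rw [div_mul_cancel₀ _ hs0.ne', div_mul_cancel₀ _ hs1.ne']
    · exact if_neg (not_le.2 h)
  · beta_reduce
    split_ifs with h
    · refine ⟨?_, sub_le_self _ (mul_nonneg (div_nonneg (by linarith) hs0.le) ht.1)⟩
      have := hcv (show (0 : ℝ) ∈ Icc (0 : ℝ) 1 by simp) hsI
        (sub_nonneg.2 ((div_le_one hs0).2 h)) (div_nonneg ht.1 hs0.le) (sub_add_cancel 1 (t / s))
      simp only [smul_eq_mul, hA.at_zero, mul_zero, zero_add, div_mul_cancel₀ _ hs0.ne'] at this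
      refine this.trans_eq ?_
      ring
    · push Not at h
      have ht1 : 0 ≤ 1 - t := sub_nonneg.2 ht.2
      refine ⟨?_, sub_le_self _ (mul_nonneg (div_nonneg (by linarith) hs1.le) ht1)⟩
      have := hcv (show (1 : ℝ) ∈ Icc (0 : ℝ) 1 by simp) hsI
        (sub_nonneg.2 ((div_le_one hs1).2 (by linarith))) (div_nonneg ht1 hs1.le)
        (sub_add_cancel 1 ((1 - t) / (1 - s)))
      have e : (1 - (1 - t) / (1 - s)) * 1 + (1 - t) / (1 - s) * s = t := by
        field_simp; ring
      simp only [smul_eq_mul, hA.at_one, e] at this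
      refine this.trans_eq ?_
      ring

/-- The derivative `-2 / (1 + u) ^ 3` is at most `-1 / 4` on `[0, 1]`, with equality at `u = 1`. -/
lemma inv_sq_add_le {a c : ℝ} (ha : 0 ≤ a) (hac : a ≤ c) (hc : c ≤ 1) :
    1 / (1 + c) ^ 2 + 1 / 4 * ((1 - a) - (1 - c)) ≤ 1 / (1 + a) ^ 2 := by
  have hp : 0 < 1 + a := by linarith
  have hq : 0 < 1 + c := by linarith
  have e : 1 / (1 + a) ^ 2 - 1 / (1 + c) ^ 2 =
      (c - a) * ((2 + a + c) / ((1 + a) ^ 2 * (1 + c) ^ 2)) := by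
    field_simp; ring
  -- This amounts to `a c ≤ 1`; it bounds the difference quotient below by `1 / ((1 + a) (1 + c))`.
  have h1 : (1 + a) * (1 + c) ≤ 2 + a + c := by nlinarith
  have h2 : (1 + a) * (1 + c) ≤ 4 := by nlinarith
  have h3 : 1 / 4 ≤ (2 + a + c) / ((1 + a) ^ 2 * (1 + c) ^ 2) := by
    rw [div_le_div_iff₀ (by norm_num) (by positivity)]
    have := mul_le_mul h2 h1 (mul_pos hp hq).le (by norm_num)
    linarith
  have := mul_le_mul_of_nonneg_left h3 (sub_nonneg.2 hac)
  linarith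

/-- A lower bound for the integral in Spearman's rho in terms of one value of `A`. -/
lemma le_integral_inv_sq (hA : IsPickands A) {s : ℝ} (hs : s ∈ Ioo (0 : ℝ) 1) :
    1 / (1 + A s) + (2 * (∫ t in Ioo (0 : ℝ) 1, (1 - A t)) - (1 - A s)) / 4 ≤
      2 * ∫ t in Ioo (0 : ℝ) 1, 1 / (1 + A t) ^ 2 := by
  obtain ⟨T, hT, hAT⟩ := hA.exists_isTent_le hs
  have hb := hT.pos
  have iA : IntegrableOn (fun t => 1 - A t) (Ioo 0 1) := (integrable_const 1).sub hA.integrableOn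
  have iA2 : IntegrableOn (fun t => 1 / (1 + A t) ^ 2) (Ioo 0 1) := by
    have : ContinuousOn (fun t => 1 / (1 + A t) ^ 2) (Icc 0 1) :=
      continuousOn_const.div ((continuousOn_const.add hA.continuousOn).pow 2)
        fun t ht => pow_ne_zero 2 (by linarith [hA.half_le ht])
    exact this.integrableOn_Icc.mono_set Ioo_subset_Icc_self
  obtain ⟨iT, eT⟩ := hT.integral_one_sub
  obtain ⟨iT2, eT2⟩ := hT.integral_inv_sq
  have iR : IntegrableOn (fun t => 1 / 4 * ((1 - A t) - (1 - T t))) (Ioo 0 1) :=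
    (iA.sub iT).const_mul _
  have := setIntegral_mono_on (iT2.add iR) iA2 measurableSet_Ioo fun t ht => by
    have htI := Ioo_subset_Icc_self ht
    exact inv_sq_add_le (by linarith [hA.half_le htI]) (hAT t htI).1 (hAT t htI).2
  simp only [Pi.add_apply] at this
  rw [integral_add iT2 iR, integral_const_mul, integral_sub iA iT, eT, eT2] at this
  have e : 1 / (1 + A s) = 2 * (1 / (2 * (1 + A s))) := by field_simp
  rw [e]
  linarith

/-- A Pickands function attains its minimum in the open interval. -/
lemma exists_min (hA : IsPickands A) :
    ∃ s ∈ Ioo (0 : ℝ) 1, ∀ t ∈ Icc (0 : ℝ) 1, A s ≤ A t := by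
  obtain ⟨s, hs, hmin⟩ := isCompact_Icc.exists_isMinOn (nonempty_Icc.2 zero_le_one) hA.continuousOn
  by_cases h : s ∈ Ioo (0 : ℝ) 1
  · exact ⟨s, h, fun t ht => hmin ht⟩
  -- A minimum at an endpoint has value 1, so `A` is constant and any interior point will do.
  have h1 : A s = 1 := by
    rcases eq_or_lt_of_le hs.1 with rfl | h0
    · exact hA.at_zero
    rcases eq_or_lt_of_le hs.2 with rfl | h1
    · exact hA.at_one
    exact absurd ⟨h0, h1⟩ h
  refine ⟨1 / 2, by norm_num, fun t ht => ?_⟩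
  have h2 : A s ≤ A t := hmin ht
  have h3 := (hA.2 (1 / 2) (by norm_num)).2
  linarith

/-- This crude bound, from `C ≥ 0`, serves only to make the denominator `2 + τ` positive. -/
lemma neg_one_le_kendallTau (hA : IsPickands A) : -1 ≤ kendallTau (evCopula A) := by
  have hμ := hA.isCopulaMeasure
  have : 0 ≤ ∫ p, evCopula A p.1 p.2 ∂copulaMeasure (evCopula A) := by
    refine integral_nonneg_of_ae ?_
    filter_upwards [ae_mem_Ioo_of_map_eq measurable_fst hμ.map_fst,
      ae_mem_Ioo_of_map_eq measurable_snd hμ.map_snd] with p h1 h2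
    exact copula_nonneg h1.1.le h2.1.le
  rw [kendallTau]
  linarith

lemma kendallTau_bound_le_spearmanRho (hA : IsPickands A) :
    3 * kendallTau (evCopula A) / (2 + kendallTau (evCopula A)) ≤ spearmanRho (evCopula A) := by
  obtain ⟨s, hs, hmin⟩ := hA.exists_min
  have hsI := Ioo_subset_Icc_self hs
  have hb : 0 < A s := by linarith [hA.half_le hsI]
  have hτ := hA.kendallTau_le hb hmin
  have hρ := hA.le_integral_inv_sq hs
  have hτ1 := hA.neg_one_le_kendallTau
  obtain ⟨T, hT, hAT⟩ := hA.exists_isTent_le hs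
  -- Half of `1 - b` is the area above the tent; this is `d ≥ 0`.
  have hM : (1 - A s) / 2 ≤ ∫ t in Ioo (0 : ℝ) 1, (1 - A t) := by
    rw [← hT.integral_one_sub.2]
    exact setIntegral_mono_on hT.integral_one_sub.1 ((integrable_const 1).sub hA.integrableOn)
      measurableSet_Ioo fun t ht => by linarith [(hAT t (Ioo_subset_Icc_self ht)).1]
  rw [hA.spearmanRho_eq]
  generalize ∫ t in Ioo (0 : ℝ) 1, 1 / (1 + A t) ^ 2 = I at *
  generalize ∫ t in Ioo (0 : ℝ) 1, (1 - A t) = M at *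
  generalize kendallTau (evCopula A) = τ at *
  generalize A s = b at *
  have h2τ : 0 < 2 + τ := by linarith
  have key : (1 - 2 * I) * (2 + τ) ≤ 1 := by
    -- Multiplying the two upper bounds needs the bound on `1 - 2 I` to be nonnegative; otherwise
    -- the claim is trivial.
    rcases le_or_gt (1 - 2 * I) 0 with h | h
    · linarith [mul_nonpos_of_nonpos_of_nonneg h h2τ.le]
    set d := 2 * M - (1 - b) with hd
    have hd0 : 0 ≤ d := by linarith
    have h1 : 1 - 2 * I ≤ b / (1 + b) - d / 4 := by
      have : b / (1 + b) = 1 - 1 / (1 + b) := by field_simp; ring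
      linarith
    have h2 : 2 + τ ≤ (1 + b + d) / b := by
      have : (1 + b + d) / b = 2 + 2 * M / b := by rw [hd]; field_simp; ring
      linarith
    refine (mul_le_mul h1 h2 h2τ.le (h.le.trans h1)).trans ?_
    -- The square appears as `(1 + b) ^ 2 - 4 b = (1 - b) ^ 2`.
    have e : (b / (1 + b) - d / 4) * ((1 + b + d) / b) =
        1 - d * ((1 - b) ^ 2 + (1 + b) * d) / (4 * b * (1 + b)) := by
      field_simp; ring
    rw [e]
    exact sub_le_self _ (by positivity)
  rw [div_le_iff₀ h2τ]
  linarith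

end IsPickands

/-! ### Sharpness and the theorem -/

/-- The symmetric triangular function with minimum `b`. -/
lemma exists_isPickands_isTriangular_isTent {b : ℝ} (hb : b ∈ Icc (1 / 2 : ℝ) 1) :
    ∃ A, IsPickands A ∧ IsTriangular A ∧ IsTent A (1 / 2) b := by
  have hb1 : 0 ≤ 1 - b := by linarith [hb.2]
  have hl : ∀ t ∈ Icc (0 : ℝ) (1 / 2), max (1 - 2 * (1 - b) * t) (1 - 2 * (1 - b) * (1 - t)) =
      1 - 2 * (1 - b) * t := fun t ht => max_eq_left (by nlinarith [ht.2])
  have hr : ∀ t ∈ Icc (1 / 2 : ℝ) 1, max (1 - 2 * (1 - b) * t) (1 - 2 * (1 - b) * (1 - t)) =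
      1 - 2 * (1 - b) * (1 - t) := fun t ht => max_eq_right (by nlinarith [ht.1])
  refine ⟨fun t => max (1 - 2 * (1 - b) * t) (1 - 2 * (1 - b) * (1 - t)), ⟨?_, fun t ht => ?_⟩,
    ⟨1 / 2, by norm_num, ⟨1, -(2 * (1 - b)), fun t ht => (hl t ht).trans (by ring)⟩,
      1 - 2 * (1 - b), 2 * (1 - b), fun t ht => (hr t ht).trans (by ring)⟩,
    by norm_num, by linarith [hb.1], hb.2, fun t ht => (hl t ht).trans (by ring),
    fun t ht => (hr t ht).trans (by ring)⟩
  · refine ConvexOn.sup ⟨convex_Icc 0 1, fun x _ y _ p q _ _ hpq => le_of_eq ?_⟩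
      ⟨convex_Icc 0 1, fun x _ y _ p q _ _ hpq => le_of_eq ?_⟩
    · simp only [smul_eq_mul]
      linear_combination -hpq
    · simp only [smul_eq_mul]
      linear_combination (2 * (1 - b) - 1) * hpq
  · have h1 : 2 * (1 - b) * t ≤ t := by nlinarith [ht.1, hb.1]
    have h2 : 2 * (1 - b) * (1 - t) ≤ 1 - t := by nlinarith [ht.2, hb.1]
    refine ⟨max_le_max (by linarith) (by linarith), max_le ?_ ?_⟩
    · linarith [mul_nonneg hb1 ht.1]
    · linarith [mul_nonneg hb1 (sub_nonneg.2 ht.2)]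

theorem theorem1 :
    (∀ A : ℝ → ℝ, IsPickands A →
      3 * kendallTau (evCopula A) / (2 + kendallTau (evCopula A)) ≤ spearmanRho (evCopula A)) ∧
    (∀ u ∈ Set.Icc (0 : ℝ) 1, ∃ A : ℝ → ℝ, IsPickands A ∧ IsTriangular A ∧
      kendallTau (evCopula A) = u ∧ spearmanRho (evCopula A) = 3 * u / (2 + u)) ∧
    (∀ A : ℝ → ℝ, IsPickands A → IsTriangular A →
      spearmanRho (evCopula A) =
        3 * kendallTau (evCopula A) / (2 + kendallTau (evCopula A))) := by
  refine ⟨fun A hA => hA.kendallTau_bound_le_spearmanRho, fun u hu => ?_, fun A hA hT => ?_⟩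
  · have hu1 : 0 < 1 + u := by linarith [hu.1]
    -- The height `b = 1 / (1 + u)` solves `(1 - b) / b = u`, and `u ≤ 1` gives `b ≥ 1 / 2`.
    obtain ⟨A, hA, hT, ht⟩ := exists_isPickands_isTriangular_isTent (b := 1 / (1 + u))
      ⟨one_div_le_one_div_of_le hu1 (by linarith [hu.2]),
        (div_le_one hu1).2 (by linarith [hu.1])⟩
    have hτ : kendallTau (evCopula A) = u := by
      rw [ht.kendallTau_eq hA]
      field_simp
      ring
    exact ⟨A, hA, hT, hτ, by rw [ht.spearmanRho_eq_kendallTau hA, hτ]⟩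
  · obtain ⟨x, b, h⟩ := hA.isTent_of_isTriangular hT
    exact h.spearmanRho_eq_kendallTau hA
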